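/- **Setting.** Let $G$ be a finite abelian group, $\hat G=\mathrm{Hom}(G,\mathbb Q/\mathbb Z)$, $n\in\mathbb N$, and let $E$ be a CW complex with set of $i$-cells $\mathcal E_i$ ($\mathcal E_i=\emptyset$ for $i<0$) and, after a choice of orientations of the cells $e_\alpha$, incidence numbers $d_{\alpha\beta}\in\mathbb Z$ ($\alpha\in\mathcal E_{i+1}$, $\beta\in\mathcal E_i$), i.e. $d_{\alpha\beta}$ is the coefficient of $e_\beta$ in the cellular boundary of $e_\alpha$. Assume that for every $\beta$ only finitely many $d_{\alpha\beta}$ are nonzero. For an abelian group $A$ let $\prod_{\mathcal E_i}A$ be the group of formal, possibly infinite, combinations $\sum_\alpha x_\alpha e_\alpha$ of $i$-cells and $\bigoplus_{\mathcal E_i}A$ the subgroup of those with finite support. Put $C^{\mathrm{lf}}_i(E;\hat G)=\prod_{\mathcal E_i}\hat G\supseteq C_i(E;\hat G)=\bigoplus_{\mathcal E_i}\hat G$ with boundary $\partial(\sum_\alpha\chi_\alpha e_\alpha)=\sum_\beta(\sum_\alpha d_{\alpha\beta}\chi_\alpha)e_\beta$, and $C^i(E;G)=\prod_{\mathcal E_i}G\supseteq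 C^i_{\mathrm{lf}}(E;G)=\bigoplus_{\mathcal E_i}G$ with coboundary $\partial^T(\sum_\beta g_\beta e_\beta)=\sum_\alpha(\sum_\beta d_{\alpha\beta}g_\beta)e_\alpha$. For $b$ a chain and $a$ a cochain, one of them of finite support, $\langle b,a\rangle=\sum_\alpha b_\alpha(a_\alpha)\in\mathbb Q/\mathbb Z$. For a finite set $K$ of cells, $x_K$ denotes the part of $x$ supported on $K$. **Homology at infinity.** $H^\infty_i(E;\hat G)$ is the homology at $C_i(E;\hat G)\oplus C^{\mathrm{lf}}_{i+1}(E;\hat G)$ of the mapping cone with boundary $(b,d)\mapsto(-\partial b,\,b+\partial d)$, and $H_\infty^i(E;G)$ is the cohomology at $C_{\mathrm{lf}}^{i+1}(E;G)\oplus C^i(E;G)$ of the mapping cone with coboundary $(a,c)\mapsto(-\partial^Ta,\,a+\partial^Tc)$. If $d\in C^{\mathrm{lf}}_{i+1}(E;\hat G)$ has finite boundary, $[d]^\infty\in H_i^\infty(E;\hat G)$ is the class of $(-\partial d,d)$; if $c\in C^i(E;G)$ has finite coboundary, $[c]_\infty\in H^i_\infty(E;G)$ is the class of $(-\partial^Tc,c)$.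 There is a well-defined bilinear pairing $H^\infty_i(E;\hat G)\times H_\infty^i(E;G)\to\mathbb Q/\mathbb Z$, $\langle[d]^\infty,[c]_\infty\rangle=\langle d,\partial^Tc\rangle-\langle\partial d,c\rangle$. **The model.** $\mathfrak A$ is the quasi-local algebra with a copy of $\ell^2(G)$ at every $n$-cell, i.e. the C*-algebra direct limit of the algebras $B(\ell^2(G)^{\otimes\Lambda})$, $\Lambda\subseteq\mathcal E_n$ finite. For $a\in C^n_{\mathrm{lf}}(E;G)$ and $b\in C_n(E;\hat G)$, $X^a,Z^b\in\mathfrak A$ are the unitaries $X^a=\prod_\alpha(X^{a_\alpha})_\alpha$, $Z^b=\prod_\alpha(Z^{b_\alpha})_\alpha$, where $X^g|h\rangle=|g+h\rangle$ and $Z^\chi|h\rangle=e^{2\pi i\chi(h)}|h\rangle$. For $\gamma\in C^{\mathrm{lf}}_n(E;\hat G)$ and $\delta\in C^n(E;G)$ put $\rho_\gamma(A)=\lim_K Z^{\gamma_K}AZ^{-\gamma_K}$ and $\rho_\delta(A)=\lim_KX^{\delta_K}AX^{-\delta_K}$ (norm limits over the finite subsets $K\subseteq\mathcal E_n$) and $\rho_{(\gamma,\delta)}=\rho_\gamma\circ\rho_\delta$.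 A state $\omega$ on $\mathfrak A$ is an *asymptotic ground state* if for every $\varepsilon>0$ there are finite sets $K_\pm\subseteq\mathcal E_{n\pm1}$ such that $|\omega(X^{\partial^Tc}Z^{\partial d})-1|<\varepsilon$ for all $c\in C^{n-1}_{\mathrm{lf}}(E;G)$ and $d\in C_{n+1}(E;\hat G)$ with $\operatorname{supp}c\cap K_-=\emptyset$ and $\operatorname{supp}d\cap K_+=\emptyset$. With $(\pi_\omega,\mathcal H_\omega)$ the GNS representation, the *polarization* of $\omega$ is the unitary representation $P_\omega$ of the group $H^\infty_n(E;\hat G)\times H_\infty^{n-1}(E;G)$ on $\mathcal H_\omega$ such that, for all $d\in C^{\mathrm{lf}}_{n+1}(E;\hat G)$ with finite boundary and all $c\in C^{n-1}(E;G)$ with finite coboundary, $P_\omega([d]^\infty,[c]_\infty)$ is the limit in the strong operator topology of $\pi_\omega\bigl(X^{\partial^T(c-c_{K_-})}Z^{\partial(d-d_{K_+})}\bigr)$ over the finite sets $K_\pm\subseteq\mathcal E_{n\pm1}$. (It is unique if it exists.) **Proposition 7.6.** Let $\omega$ be an asymptotic ground state on $\mathfrak A$, and let $\gamma\in C_n^{\mathrm{lf}}(E;\hat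 G)$ have finite boundary and $\delta\in C^n(E;G)$ have finite coboundary. Then $\omega'=\omega\circ\rho_{(\gamma,\delta)}$ is again an asymptotic ground state. Moreover $\omega$ and $\omega'$ have polarizations $P_\omega$, $P_{\omega'}$, and $P_{\omega'}$ is unitarily isomorphic to $P_\omega\otimes V_{(\gamma,\delta)}$ (on $\mathcal H_\omega\otimes\mathbb C$), where $V_{(\gamma,\delta)}$ is the one-dimensional representation of $H^\infty_n(E;\hat G)\times H_\infty^{n-1}(E;G)$ in which $([d]^\infty,[c]_\infty)$ acts as multiplication by $$e^{2\pi i\left(\langle[\gamma]^\infty,[c]_\infty\rangle+\langle[d]^\infty,[\delta]_\infty\rangle\right)}.$$ -/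

import Mathlib

open CategoryTheory Filter Topology
open scoped TensorProduct ComplexOrder

universe u v

noncomputable section

namespace CellularKitaev

/-! ### Singular homology of pairs and triples -/

section Singular

variable {X : Type u} [TopologicalSpace X]

/-- The singular chain complex (integer coefficients) of a subspace `A ⊆ X`. -/
abbrev singularChains (A : Set X) : ChainComplex (ModuleCat.{u} ℤ) ℕ :=
  ((AlgebraicTopology.singularChainComplexFunctor (ModuleCat.{u} ℤ)).obj
    (ModuleCat.of ℤ (ULift.{u} ℤ))).obj (TopCat.of A)

/-- The chain map induced by an inclusion of subspaces. -/
abbrev singularChainsMap {A B : Set X} (h : A ⊆ B) : singularChains A ⟶ singularChains B :=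
  ((AlgebraicTopology.singularChainComplexFunctor (ModuleCat.{u} ℤ)).obj
    (ModuleCat.of ℤ (ULift.{u} ℤ))).map
      (TopCat.ofHom ⟨Set.inclusion h, continuous_inclusion h⟩)

instance {A B : Set X} (h : A ⊆ B) : Mono (singularChainsMap h) := by
  have : Mono (TopCat.ofHom (⟨Set.inclusion h, continuous_inclusion h⟩ : C(A, B))) :=
    (TopCat.mono_iff_injective _).2 (Set.inclusion_injective h)
  exact Functor.map_mono _ _

lemma singularChainsMap_comp {A B C : Set X} (h : A ⊆ B) (h' : B ⊆ C) :
    singularChainsMap h ≫ singularChainsMap h' = singularChainsMap (h.trans h') := by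
  exact (Functor.map_comp _ _ _).symm

/-- The pair `A ⊆ B` as a short complex `S(A) ⟶ S(B) ⟶ S(B)/S(A)` of chain complexes. -/
abbrev pairComplex {A B : Set X} (h : A ⊆ B) :
    ShortComplex (ChainComplex (ModuleCat.{u} ℤ) ℕ) :=
  ShortComplex.mk (singularChainsMap h) (Limits.cokernel.π (singularChainsMap h))
    (Limits.cokernel.condition _)

lemma pairComplex_shortExact {A B : Set X} (h : A ⊆ B) : (pairComplex h).ShortExact where
  exact := ShortComplex.exact_cokernel _
  mono_f := inferInstanceAs (Mono (singularChainsMap h))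
  epi_g := inferInstanceAs (Epi (Limits.coequalizer.π _ _))

/-- Relative singular homology `H_i(B, A; ℤ)`. -/
abbrev relHomology {A B : Set X} (h : A ⊆ B) (i : ℕ) : ModuleCat.{u} ℤ :=
  (pairComplex h).X₃.homology i

/-- The map `H_i(B, A) ⟶ H_i(B', A')` induced by an inclusion of pairs. -/
def relHomologyMap {A B A' B' : Set X} (h : A ⊆ B) (h' : A' ⊆ B') (hA : A ⊆ A') (hB : B ⊆ B')
    (i : ℕ) : relHomology h i ⟶ relHomology h' i :=
  HomologicalComplex.homologyMap
    (Limits.cokernel.map (singularChainsMap h) (singularChainsMap h')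
      (singularChainsMap hA) (singularChainsMap hB)
      (by rw [singularChainsMap_comp, singularChainsMap_comp])) i

/-- The boundary map `H_{i+1}(D, B) ⟶ H_i(B) ⟶ H_i(B, A)` of a triple `A ⊆ B ⊆ D`. -/
def tripleBoundary {A B D : Set X} (h : A ⊆ B) (h' : B ⊆ D) (i : ℕ) :
    relHomology h' (i + 1) ⟶ relHomology h i :=
  (pairComplex_shortExact h').δ (i + 1) i (ComplexShape.down_mk _ _ rfl) ≫
    HomologicalComplex.homologyMap (pairComplex h).g i

lemma tripleBoundary_comp {A B D F : Set X} (h : A ⊆ B) (h' : B ⊆ D) (h'' : D ⊆ F) (i : ℕ) :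
    tripleBoundary h' h'' (i + 1) ≫ tripleBoundary h h' i = 0 := by
  have key : HomologicalComplex.homologyMap (pairComplex h').g (i + 1) ≫
      (pairComplex_shortExact h').δ (i + 1) i (ComplexShape.down_mk _ _ rfl) = 0 :=
    (pairComplex_shortExact h').comp_δ (i + 1) i (ComplexShape.down_mk _ _ rfl)
  unfold tripleBoundary
  rw [Category.assoc, reassoc_of% key, Limits.zero_comp, Limits.comp_zero]

end Singular

/-! ### Chains, homology at infinity and the pairing -/

/-- The combinatorial data of a cell complex: the cells, their dimensions and the incidence numbers
`d_{αβ}`, where every cell has nonzero incidence number with only finitely many cells. The data of a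
CW complex are constructed in `CellOrientation.cellularData` below. -/
structure CellularData : Type (u + 1) where
  /-- The set of cells (of all dimensions). -/
  cell : Type u
  /-- The dimension of a cell. -/
  dim : cell → ℕ
  /-- The incidence number `d_{αβ}`. -/
  incidence : cell → cell → ℤ
  /-- Incidence numbers vanish unless `dim α = dim β + 1`. -/
  dim_eq : ∀ α β, incidence α β ≠ 0 → dim α = dim β + 1
  /-- The boundary of a cell has finite support. -/
  finite_faces : ∀ α, {β | incidence α β ≠ 0}.Finite
  /-- The coboundary of a cell has finite support. -/
  finite_cofaces : ∀ β, {α | incidence α β ≠ 0}.Finite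
  /-- `∂² = 0`. -/
  incidence_comp : ∀ α γ, ∑ᶠ β, incidence α β * incidence β γ = 0

section LocallyFiniteMatrix

variable {ι : Type u} {A : Type v} [AddCommGroup A]

lemma exists_ne_zero_of_finsum_ne {f : ι → A} (h : ∑ᶠ α, f α ≠ 0) : ∃ α, f α ≠ 0 := by
  by_contra! h0
  exact h (finsum_eq_zero_of_forall_eq_zero h0)

lemma finsum_matrix_eq_sum (m : ι → ι → ℤ) (x : ι → A) (β : ι) (T : Finset ι)
    (hT : ∀ α, m α β • x α ≠ 0 → α ∈ T) :
    ∑ᶠ α, m α β • x α = ∑ α ∈ T, m α β • x α :=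
  finsum_eq_sum_of_support_subset _ fun α hα => hT α hα

/-- The action `(m x)_β = ∑_α m_{αβ} x_α` of an integer matrix with finite columns. -/
def matrixAct (m : ι → ι → ℤ) (hm : ∀ β, {α | m α β ≠ 0}.Finite) : (ι → A) →+ (ι → A) where
  toFun x β := ∑ᶠ α, m α β • x α
  map_zero' := by funext β; simp
  map_add' x y := by
    funext β
    have h : ∀ z : ι → A, ∑ᶠ α, m α β • z α = ∑ α ∈ (hm β).toFinset, m α β • z α := fun z =>
      finsum_matrix_eq_sum m z β _ fun α hα => by
        rw [Set.Finite.mem_toFinset]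
        exact fun h0 => hα (by rw [h0, zero_smul])
    simp only [Pi.add_apply, h, ← Finset.sum_add_distrib, ← smul_add]

lemma matrixAct_apply (m : ι → ι → ℤ) (hm : ∀ β, {α | m α β ≠ 0}.Finite) (x : ι → A) (β : ι) :
    matrixAct m hm x β = ∑ᶠ α, m α β • x α := rfl

lemma finite_support_matrixAct (m : ι → ι → ℤ) (hm : ∀ β, {α | m α β ≠ 0}.Finite)
    (hm' : ∀ α, {β | m α β ≠ 0}.Finite) (x : ι → A) (hx : x.support.Finite) :
    (matrixAct m hm x).support.Finite := by
  refine (hx.biUnion fun α _ => hm' α).subset fun β hβ => ?_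
  obtain ⟨α, hα⟩ := exists_ne_zero_of_finsum_ne (f := fun α => m α β • x α) hβ
  refine Set.mem_biUnion (x := α) (fun h0 => hα ?_) (fun h0 => hα ?_)
  · rw [h0, smul_zero]
  · rw [h0, zero_smul]

lemma matrixAct_matrixAct (m : ι → ι → ℤ) (hm : ∀ β, {α | m α β ≠ 0}.Finite)
    (hmm : ∀ α γ, ∑ᶠ β, m α β * m β γ = 0) (x : ι → A) :
    matrixAct m hm (matrixAct m hm x) = 0 := by
  classical
  funext γ
  have hT : ∀ α β, m β γ ≠ 0 → m α β ≠ 0 →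
      α ∈ (hm γ).toFinset.biUnion fun β => (hm β).toFinset := fun α β h1 h2 =>
    Finset.mem_biUnion.2 ⟨β, (hm γ).mem_toFinset.2 h1, (hm β).mem_toFinset.2 h2⟩
  rw [matrixAct_apply, finsum_matrix_eq_sum m _ γ (hm γ).toFinset fun β hβ => by
    rw [Set.Finite.mem_toFinset]
    exact fun h0 => hβ (by rw [h0, zero_smul])]
  have h1 : ∀ β ∈ (hm γ).toFinset, m β γ • matrixAct m hm x β =
      ∑ α ∈ (hm γ).toFinset.biUnion (fun β => (hm β).toFinset), (m α β * m β γ) • x α := by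
    intro β hβ
    rw [matrixAct_apply, finsum_matrix_eq_sum m x β _ fun α hα =>
      hT α β ((hm γ).mem_toFinset.1 hβ) fun h0 => hα (by rw [h0, zero_smul]), Finset.smul_sum]
    exact Finset.sum_congr rfl fun α _ => by rw [smul_smul, mul_comm]
  rw [Finset.sum_congr rfl h1, Finset.sum_comm]
  refine Finset.sum_eq_zero fun α _ => ?_
  rw [← Finset.sum_smul, ← finsum_eq_sum_of_support_subset _ (fun β hβ => ?_), hmm, zero_smul]
  rw [Set.Finite.coe_toFinset]
  exact fun h0 => hβ (by simp [h0])

end LocallyFiniteMatrix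

section Pairing

variable {ι : Type u} {G : Type v} [AddCommGroup G]

/-- The pairing `⟨x, y⟩ = ∑_α x_α(y_α)`, meaningful when only finitely many terms are nonzero. -/
def pairing (x : ι → G →+ AddCircle (1 : ℚ)) (y : ι → G) : AddCircle (1 : ℚ) :=
  ∑ᶠ α, x α (y α)

lemma pairing_add_left {x x' : ι → G →+ AddCircle (1 : ℚ)} {y : ι → G}
    (h : y.support.Finite ∨ x.support.Finite ∧ x'.support.Finite) :
    pairing (x + x') y = pairing x y + pairing x' y := by
  unfold pairing
  rw [← finsum_add_distrib]
  · rfl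
  · rcases h with h | h
    · exact h.subset fun α hα h0 => hα (by simp [h0])
    · exact h.1.subset fun α hα h0 => hα (by simp [h0])
  · rcases h with h | h
    · exact h.subset fun α hα h0 => hα (by simp [h0])
    · exact h.2.subset fun α hα h0 => hα (by simp [h0])

lemma pairing_add_right {x : ι → G →+ AddCircle (1 : ℚ)} {y y' : ι → G}
    (h : x.support.Finite ∨ y.support.Finite ∧ y'.support.Finite) :
    pairing x (y + y') = pairing x y + pairing x y' := by
  unfold pairing
  rw [← finsum_add_distrib]
  · exact finsum_congr fun α => map_add (x α) _ _
  · rcases h with h | h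
    · exact h.subset fun α hα h0 => hα (by simp [h0])
    · exact h.1.subset fun α hα h0 => hα (by simp [h0])
  · rcases h with h | h
    · exact h.subset fun α hα h0 => hα (by simp [h0])
    · exact h.2.subset fun α hα h0 => hα (by simp [h0])

lemma pairing_neg_left (x : ι → G →+ AddCircle (1 : ℚ)) (y : ι → G) :
    pairing (-x) y = -pairing x y := by
  unfold pairing
  rw [← finsum_neg_distrib]
  rfl

lemma pairing_neg_right (x : ι → G →+ AddCircle (1 : ℚ)) (y : ι → G) :
    pairing x (-y) = -pairing x y := by
  unfold pairing
  rw [← finsum_neg_distrib]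
  exact finsum_congr fun α => map_neg (x α) _

lemma pairing_matrixAct (m : ι → ι → ℤ) (hm : ∀ β, {α | m α β ≠ 0}.Finite)
    (hm' : ∀ α, {β | m α β ≠ 0}.Finite) (x : ι → G →+ AddCircle (1 : ℚ)) (y : ι → G)
    (h : x.support.Finite ∨ y.support.Finite) :
    pairing (matrixAct m hm x) y = pairing x (matrixAct (fun α β => m β α) hm' y) := by
  classical
  obtain ⟨P, Q, h1, h2, h3, h4⟩ : ∃ P Q : Finset ι,
      (∀ α β, β ∈ Q → m α β • x α ≠ 0 → α ∈ P) ∧ (∀ α β, α ∈ P → m α β • y β ≠ 0 → β ∈ Q) ∧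
      (∀ β, β ∉ Q → matrixAct m hm x β (y β) = 0) ∧
      (∀ α, α ∉ P → x α (matrixAct (fun α β => m β α) hm' y α) = 0) := by
    rcases h with h | h
    · refine ⟨h.toFinset, h.toFinset.biUnion fun α => (hm' α).toFinset, fun α β _ h0 => ?_,
        fun α β hα h0 => ?_, fun β hβ => ?_, fun α hα => ?_⟩
      · exact h.mem_toFinset.2 fun h1 => h0 (by simp [h1])
      · exact Finset.mem_biUnion.2
          ⟨α, hα, (hm' α).mem_toFinset.2 fun h1 => h0 (by simp [h1])⟩
      · have : matrixAct m hm x β = 0 := by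
          rw [matrixAct_apply]
          refine finsum_eq_zero_of_forall_eq_zero fun α => ?_
          by_contra h0
          refine hβ (Finset.mem_biUnion.2 ⟨α, h.mem_toFinset.2 fun h1 => h0 ?_,
            (hm' α).mem_toFinset.2 fun h1 => h0 ?_⟩)
          · simp [h1]
          · simp [h1]
        rw [this, AddMonoidHom.zero_apply]
      · have : x α = 0 := by
          by_contra h0
          exact hα (h.mem_toFinset.2 h0)
        rw [this, AddMonoidHom.zero_apply]
    · refine ⟨h.toFinset.biUnion fun β => (hm β).toFinset, h.toFinset, fun α β hβ h0 => ?_,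
        fun α β _ h0 => ?_, fun β hβ => ?_, fun α hα => ?_⟩
      · exact Finset.mem_biUnion.2
          ⟨β, hβ, (hm β).mem_toFinset.2 fun h1 => h0 (by simp [h1])⟩
      · exact h.mem_toFinset.2 fun h1 => h0 (by simp [h1])
      · have : y β = 0 := by
          by_contra h0
          exact hβ (h.mem_toFinset.2 h0)
        rw [this, map_zero]
      · have : matrixAct (fun α β => m β α) hm' y α = 0 := by
          rw [matrixAct_apply]
          refine finsum_eq_zero_of_forall_eq_zero fun β => ?_
          by_contra h0
          refine hα (Finset.mem_biUnion.2 ⟨β, h.mem_toFinset.2 fun h1 => h0 ?_,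
            (hm β).mem_toFinset.2 fun h1 => h0 ?_⟩)
          · simp [h1]
          · simp [h1]
        rw [this, map_zero]
  unfold pairing
  rw [finsum_eq_sum_of_support_subset (s := Q) _ fun β hβ => by
      by_contra h0
      exact hβ (h3 β h0),
    finsum_eq_sum_of_support_subset (s := P) _ fun α hα => by
      by_contra h0
      exact hα (h4 α h0)]
  have hL : ∀ β ∈ Q, matrixAct m hm x β (y β) = ∑ α ∈ P, m α β • x α (y β) := by
    intro β hβ
    rw [matrixAct_apply, finsum_matrix_eq_sum m x β P fun α => h1 α β hβ]
    simp
  have hR : ∀ α ∈ P, x α (matrixAct (fun α β => m β α) hm' y α) =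
      ∑ β ∈ Q, m α β • x α (y β) := by
    intro α hα
    rw [matrixAct_apply,
      finsum_matrix_eq_sum (fun α β => m β α) y α Q fun β => h2 α β hα, map_sum]
    simp
  rw [Finset.sum_congr rfl hL, Finset.sum_congr rfl hR, Finset.sum_comm]

end Pairing

namespace CellularData

variable (E : CellularData.{u}) (A : Type v) [AddCommGroup A]

/-- The boundary map `∂ (∑_α x_α e_α) = ∑_β (∑_α d_{αβ} x_α) e_β` on formal infinite linear
combinations of cells with coefficients in `A`, written as functions on the set of cells. -/
def boundary : (E.cell → A) →+ (E.cell → A) := matrixAct E.incidence E.finite_cofaces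

/-- The coboundary map `∂ᵀ (∑_β x_β e_β) = ∑_α (∑_β d_{αβ} x_β) e_α`. -/
def coboundary : (E.cell → A) →+ (E.cell → A) :=
  matrixAct (fun α β => E.incidence β α) E.finite_faces

variable {A}

lemma boundary_apply (x : E.cell → A) (β : E.cell) :
    E.boundary A x β = ∑ᶠ α, E.incidence α β • x α := rfl

lemma coboundary_apply (x : E.cell → A) (α : E.cell) :
    E.coboundary A x α = ∑ᶠ β, E.incidence α β • x β := rfl

lemma boundary_boundary (x : E.cell → A) : E.boundary A (E.boundary A x) = 0 :=
  matrixAct_matrixAct _ _ E.incidence_comp x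

lemma coboundary_coboundary (x : E.cell → A) : E.coboundary A (E.coboundary A x) = 0 :=
  matrixAct_matrixAct _ _ (fun α γ => by simpa only [mul_comm] using E.incidence_comp γ α) x

lemma finite_support_boundary {x : E.cell → A} (hx : x.support.Finite) :
    (E.boundary A x).support.Finite :=
  finite_support_matrixAct _ _ E.finite_faces x hx

lemma finite_support_coboundary {x : E.cell → A} (hx : x.support.Finite) :
    (E.coboundary A x).support.Finite :=
  finite_support_matrixAct _ _ E.finite_cofaces x hx

variable (A) in
/-- The group `∏_{α ∈ 𝓔_i} A` of all formal linear combinations of `i`-cells: the locally finite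
chains `C^lf_i(E; A)`, and also the cochains `C^i(E; A)`. It is zero for `i < 0`. -/
def chains (i : ℤ) : AddSubgroup (E.cell → A) where
  carrier := {x | ∀ α, x α ≠ 0 → (E.dim α : ℤ) = i}
  zero_mem' := fun α h => absurd rfl h
  add_mem' := fun {x y} hx hy α h => by
    by_contra hd
    have h1 : x α = 0 := by by_contra h1; exact hd (hx α h1)
    have h2 : y α = 0 := by by_contra h2; exact hd (hy α h2)
    exact h (by simp [h1, h2])
  neg_mem' := fun {x} hx α h => hx α fun h0 => h (by simp [h0])

variable (A) in
/-- The group `⨁_{α ∈ 𝓔_i} A` of finite linear combinations of `i`-cells: the chains `C_i(E; A)`,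
and also the locally finite cochains `C_lf^i(E; A)`. -/
def finChains (i : ℤ) : AddSubgroup (E.cell → A) where
  carrier := {x | x ∈ E.chains A i ∧ x.support.Finite}
  zero_mem' := ⟨zero_mem _, by simp⟩
  add_mem' := fun hx hy =>
    ⟨add_mem hx.1 hy.1, (hx.2.union hy.2).subset (Function.support_add _ _)⟩
  neg_mem' := fun hx => ⟨neg_mem hx.1, by simpa using hx.2⟩

lemma boundary_mem_chains {i : ℤ} {x : E.cell → A} (hx : x ∈ E.chains A (i + 1)) :
    E.boundary A x ∈ E.chains A i := by
  intro β hβ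
  obtain ⟨α, hα⟩ := exists_ne_zero_of_finsum_ne (f := fun α => E.incidence α β • x α) hβ
  have h1 : x α ≠ 0 := fun h0 => hα (by rw [h0, smul_zero])
  have h2 : E.incidence α β ≠ 0 := fun h0 => hα (by rw [h0, zero_smul])
  have h3 := hx α h1
  rw [E.dim_eq α β h2] at h3
  push_cast at h3
  linarith

lemma coboundary_mem_chains {i : ℤ} {x : E.cell → A} (hx : x ∈ E.chains A i) :
    E.coboundary A x ∈ E.chains A (i + 1) := by
  intro α hα
  obtain ⟨β, hβ⟩ := exists_ne_zero_of_finsum_ne (f := fun β => E.incidence α β • x β) hα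
  have h1 : x β ≠ 0 := fun h0 => hβ (by rw [h0, smul_zero])
  have h2 : E.incidence α β ≠ 0 := fun h0 => hβ (by rw [h0, zero_smul])
  rw [E.dim_eq α β h2, ← hx β h1]
  push_cast
  rfl

variable (A)

/-- The boundary `(b, d) ↦ (-∂b, b + ∂d)` of the mapping cone of `C_•(E; A) → C^lf_•(E; A)`. -/
def coneBoundary : (E.cell → A) × (E.cell → A) →+ (E.cell → A) × (E.cell → A) :=
  (-(E.boundary A).comp (AddMonoidHom.fst _ _)).prod
    (AddMonoidHom.fst _ _ + (E.boundary A).comp (AddMonoidHom.snd _ _))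

/-- The coboundary `(a, c) ↦ (-∂ᵀa, a + ∂ᵀc)` of the mapping cone of
`C_lf^•(E; A) → C^•(E; A)`. -/
def coneCoboundary : (E.cell → A) × (E.cell → A) →+ (E.cell → A) × (E.cell → A) :=
  (-(E.coboundary A).comp (AddMonoidHom.fst _ _)).prod
    (AddMonoidHom.fst _ _ + (E.coboundary A).comp (AddMonoidHom.snd _ _))

/-- The `i`-cycles at infinity: the pairs `(b, d) ∈ C_i ⊕ C^lf_{i+1}` that are cycles of the
mapping cone. -/
def cyclesAtInfinity (i : ℤ) : AddSubgroup ((E.cell → A) × (E.cell → A)) :=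
  ((E.finChains A i).prod (E.chains A (i + 1))) ⊓ (E.coneBoundary A).ker

/-- The `i`-boundaries at infinity: the image of `C_{i+1} ⊕ C^lf_{i+2}`. -/
def boundariesAtInfinity (i : ℤ) : AddSubgroup ((E.cell → A) × (E.cell → A)) :=
  ((E.finChains A (i + 1)).prod (E.chains A (i + 1 + 1))).map (E.coneBoundary A)

/-- The `i`-cocycles at infinity: the pairs `(a, c) ∈ C_lf^{i+1} ⊕ C^i` that are cocycles of the
mapping cone. -/
def cocyclesAtInfinity (i : ℤ) : AddSubgroup ((E.cell → A) × (E.cell → A)) :=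
  ((E.finChains A (i + 1)).prod (E.chains A i)) ⊓ (E.coneCoboundary A).ker

/-- The `i`-coboundaries at infinity: the image of `C_lf^i ⊕ C^{i-1}`. -/
def coboundariesAtInfinity (i : ℤ) : AddSubgroup ((E.cell → A) × (E.cell → A)) :=
  ((E.finChains A i).prod (E.chains A (i - 1))).map (E.coneCoboundary A)

/-- The homology at infinity `H^∞_i(E; A)`. (All boundaries are cycles.) -/
abbrev HomologyAtInfinity (i : ℤ) : Type (max u v) :=
  E.cyclesAtInfinity A i ⧸ (E.boundariesAtInfinity A i).addSubgroupOf (E.cyclesAtInfinity A i)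

/-- The cohomology at infinity `H_∞^i(E; A)`. (All coboundaries are cocycles.) -/
abbrev CohomologyAtInfinity (i : ℤ) : Type (max u v) :=
  E.cocyclesAtInfinity A i ⧸
    (E.coboundariesAtInfinity A i).addSubgroupOf (E.cocyclesAtInfinity A i)

variable {A}

lemma mem_cyclesAtInfinity {i j : ℤ} (hj : j = i + 1) {d : E.cell → A} (hd : d ∈ E.chains A j)
    (hfin : (E.boundary A d).support.Finite) : (-E.boundary A d, d) ∈ E.cyclesAtInfinity A i := by
  subst hj
  refine ⟨⟨⟨neg_mem (E.boundary_mem_chains hd), by simpa using hfin⟩, hd⟩, ?_⟩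
  change E.coneBoundary A _ = 0
  simp [coneBoundary, boundary_boundary]

lemma mem_cocyclesAtInfinity {i : ℤ} {c : E.cell → A} (hc : c ∈ E.chains A i)
    (hfin : (E.coboundary A c).support.Finite) :
    (-E.coboundary A c, c) ∈ E.cocyclesAtInfinity A i := by
  refine ⟨⟨⟨neg_mem (E.coboundary_mem_chains hc), by simpa using hfin⟩, hc⟩, ?_⟩
  change E.coneCoboundary A _ = 0
  simp [coneCoboundary, coboundary_coboundary]

/-- The class `[d]^∞ ∈ H^∞_i(E; A)` of `(-∂d, d)`, for a locally finite `(i + 1)`-chain `d` with finite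
boundary. -/
def homologyClass {i j : ℤ} (hj : j = i + 1) (d : E.cell → A) (hd : d ∈ E.chains A j)
    (hfin : (E.boundary A d).support.Finite) : E.HomologyAtInfinity A i :=
  QuotientAddGroup.mk ⟨(-E.boundary A d, d), E.mem_cyclesAtInfinity hj hd hfin⟩

/-- The class `[c]_∞ ∈ H_∞^i(E; A)` of `(-∂ᵀc, c)`, for an `i`-cochain `c` with finite
coboundary. -/
def cohomologyClass {i : ℤ} (c : E.cell → A) (hc : c ∈ E.chains A i)
    (hfin : (E.coboundary A c).support.Finite) : E.CohomologyAtInfinity A i :=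
  QuotientAddGroup.mk ⟨(-E.coboundary A c, c), E.mem_cocyclesAtInfinity hc hfin⟩

variable {G : Type v} [AddCommGroup G]

/-- The pairing `((b, d), (a, c)) ↦ ⟨b, c⟩ - ⟨d, a⟩` of cycles with cocycles at infinity. For
`b = -∂d` and `a = -∂ᵀc` it is `⟨d, ∂ᵀc⟩ - ⟨∂d, c⟩`. -/
def pairingCycles (i : ℤ) : E.cyclesAtInfinity (G →+ AddCircle (1 : ℚ)) i →+
    E.cocyclesAtInfinity G i →+ AddCircle (1 : ℚ) :=
  AddMonoidHom.mk' (fun z => AddMonoidHom.mk'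
      (fun w => pairing z.1.1 w.1.2 - pairing z.1.2 w.1.1)
      (fun w w' => by
        have h1 : pairing z.1.1 (w.1.2 + w'.1.2) = pairing z.1.1 w.1.2 + pairing z.1.1 w'.1.2 :=
          pairing_add_right (.inl z.2.1.1.2)
        have h2 : pairing z.1.2 (w.1.1 + w'.1.1) = pairing z.1.2 w.1.1 + pairing z.1.2 w'.1.1 :=
          pairing_add_right (.inr ⟨w.2.1.1.2, w'.2.1.1.2⟩)
        simp only [AddSubgroup.coe_add, Prod.fst_add, Prod.snd_add, h1, h2]
        abel))
    (fun z z' => by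
      ext w
      have h1 : pairing (z.1.1 + z'.1.1) w.1.2 = pairing z.1.1 w.1.2 + pairing z'.1.1 w.1.2 :=
        pairing_add_left (.inr ⟨z.2.1.1.2, z'.2.1.1.2⟩)
      have h2 : pairing (z.1.2 + z'.1.2) w.1.1 = pairing z.1.2 w.1.1 + pairing z'.1.2 w.1.1 :=
        pairing_add_left (.inl w.2.1.1.2)
      simp only [AddSubgroup.coe_add, Prod.fst_add, Prod.snd_add, h1, h2, AddMonoidHom.mk'_apply,
        AddMonoidHom.add_apply]
      abel)

lemma pairing_boundary (x : E.cell → G →+ AddCircle (1 : ℚ)) (y : E.cell → G)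
    (h : x.support.Finite ∨ y.support.Finite) :
    pairing (E.boundary _ x) y = pairing x (E.coboundary G y) :=
  pairing_matrixAct _ _ _ x y h

lemma coboundary_fst_eq_zero {i : ℤ} (w : E.cocyclesAtInfinity A i) :
    E.coboundary A w.1.1 = 0 := by
  have h := congrArg Prod.fst (AddMonoidHom.mem_ker.1 w.2.2)
  simpa [coneCoboundary] using h

lemma coboundary_snd_eq {i : ℤ} (w : E.cocyclesAtInfinity A i) :
    E.coboundary A w.1.2 = -w.1.1 := by
  have h := congrArg Prod.snd (AddMonoidHom.mem_ker.1 w.2.2)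
  exact eq_neg_of_add_eq_zero_right (by simpa [coneCoboundary] using h)

lemma boundary_fst_eq_zero {i : ℤ} (z : E.cyclesAtInfinity A i) :
    E.boundary A z.1.1 = 0 := by
  have h := congrArg Prod.fst (AddMonoidHom.mem_ker.1 z.2.2)
  simpa [coneBoundary] using h

lemma boundary_snd_eq {i : ℤ} (z : E.cyclesAtInfinity A i) :
    E.boundary A z.1.2 = -z.1.1 := by
  have h := congrArg Prod.snd (AddMonoidHom.mem_ker.1 z.2.2)
  exact eq_neg_of_add_eq_zero_right (by simpa [coneBoundary] using h)

lemma pairingCycles_boundary {i : ℤ} (z : E.cyclesAtInfinity (G →+ AddCircle (1 : ℚ)) i)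
    (hz : (z : _ × _) ∈ E.boundariesAtInfinity (G →+ AddCircle (1 : ℚ)) i) :
    E.pairingCycles (G := G) i z = 0 := by
  ext w
  obtain ⟨⟨b, f⟩, ⟨hb, hf⟩, hbf⟩ := hz
  have h1 : z.1.1 = -E.boundary _ b := by rw [← hbf]; simp [coneBoundary]
  have h2 : z.1.2 = b + E.boundary _ f := by rw [← hbf]; simp [coneBoundary]
  change pairing z.1.1 w.1.2 - pairing z.1.2 w.1.1 = 0
  rw [h1, h2, pairing_neg_left, pairing_boundary _ _ _ (.inl hb.2),
    pairing_add_left (.inl w.2.1.1.2), pairing_boundary _ f _ (.inr w.2.1.1.2),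
    coboundary_fst_eq_zero, coboundary_snd_eq, pairing_neg_right]
  simp [pairing]

lemma pairingCycles_coboundary {i : ℤ} (z : E.cyclesAtInfinity (G →+ AddCircle (1 : ℚ)) i)
    (w : E.cocyclesAtInfinity G i) (hw : (w : _ × _) ∈ E.coboundariesAtInfinity G i) :
    E.pairingCycles i z w = 0 := by
  obtain ⟨⟨a, f⟩, ⟨ha, hf⟩, haf⟩ := hw
  have h1 : w.1.1 = -E.coboundary _ a := by rw [← haf]; simp [coneCoboundary]
  have h2 : w.1.2 = a + E.coboundary _ f := by rw [← haf]; simp [coneCoboundary]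
  change pairing z.1.1 w.1.2 - pairing z.1.2 w.1.1 = 0
  rw [h1, h2, pairing_neg_right, ← pairing_boundary _ _ _ (.inr ha.2),
    pairing_add_right (.inl z.2.1.1.2), ← pairing_boundary _ _ f (.inl z.2.1.1.2),
    boundary_fst_eq_zero, boundary_snd_eq, pairing_neg_left]
  simp [pairing]

/-- The pairing `⟨[d]^∞, [c]_∞⟩ = ⟨d, ∂ᵀc⟩ - ⟨∂d, c⟩ ∈ ℚ/ℤ` of homology and cohomology at
infinity. -/
def pairingAtInfinity (i : ℤ) : E.HomologyAtInfinity (G →+ AddCircle (1 : ℚ)) i →+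
    E.CohomologyAtInfinity G i →+ AddCircle (1 : ℚ) :=
  QuotientAddGroup.lift _
    (AddMonoidHom.mk'
      (fun z => QuotientAddGroup.lift _ (E.pairingCycles i z) fun w hw =>
        E.pairingCycles_coboundary z w hw)
      (fun z z' => by
        ext w
        exact DFunLike.congr_fun (map_add (E.pairingCycles i) z z') w))
    (fun z hz => by
      have h := E.pairingCycles_boundary z hz
      rw [AddMonoidHom.mem_ker]
      ext w
      simp [h])

lemma pairingAtInfinity_class {i j : ℤ} (hj : j = i + 1)
    (d : E.cell → G →+ AddCircle (1 : ℚ)) (hd : d ∈ E.chains _ j)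
    (hd' : (E.boundary _ d).support.Finite) (c : E.cell → G) (hc : c ∈ E.chains G i)
    (hc' : (E.coboundary G c).support.Finite) :
    E.pairingAtInfinity i (E.homologyClass hj d hd hd') (E.cohomologyClass c hc hc') =
      pairing d (E.coboundary G c) - pairing (E.boundary _ d) c := by
  change pairing (-E.boundary _ d) c - pairing d (-E.coboundary G c) = _
  rw [pairing_neg_left, pairing_neg_right]
  abel

end CellularData

/-! ### The cellular chain complex of a CW complex -/

section CW

lemma finsum_repr_mul {R ι κ M N : Type*} [CommRing R] [AddCommGroup M] [AddCommGroup N]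
    [Module R M] [Module R N] (b : Module.Basis ι R M) (b' : Module.Basis κ R N) (f : M →ₗ[R] N)
    (x : M) (hx : f x = 0) (j : κ) : ∑ᶠ i, b.repr x i * b'.repr (f (b i)) j = 0 := by
  have h1 := b.linearCombination_repr x
  rw [← h1, Finsupp.linearCombination_apply, Finsupp.sum, map_sum] at hx
  have h2 := congrArg (fun y => b'.repr y j) hx
  simp only [map_sum, map_smul, map_zero, Finsupp.coe_finsetSum, Finset.sum_apply,
    Finsupp.coe_smul, Pi.smul_apply, smul_eq_mul, Finsupp.coe_zero, Pi.zero_apply] at h2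
  rw [finsum_eq_sum_of_support_subset (s := (b.repr x).support)]
  · exact h2
  · intro i hi
    exact Finsupp.mem_support_iff.2 fun h3 => hi (by simp [h3])

variable {X : Type u} [TopologicalSpace X] [T2Space X] (C : Set X) [Topology.CWComplex C]

/-- The union of the closed cells of dimension less than `k`, i.e. the `(k - 1)`-skeleton. -/
abbrev skeletonBelow (k : ℕ) : Set X := Topology.CWComplex.skeletonLT C (k : ℕ∞)

lemma skeletonBelow_mono (k : ℕ) : skeletonBelow C k ⊆ skeletonBelow C (k + 1) :=
  Topology.CWComplex.skeletonLT_mono (by exact_mod_cast Nat.le_succ k)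

lemma closedCell_subset_skeletonBelow (k : ℕ) (α : Topology.RelCWComplex.cell C k) :
    Topology.RelCWComplex.closedCell k α ⊆ skeletonBelow C (k + 1) := by
  have h := Topology.CWComplex.closedCell_subset_skeletonLT (C := C) k α
  unfold skeletonBelow
  exact_mod_cast h

/-- The cellular chain group `H_k(E^k, E^{k-1}; ℤ)`. -/
abbrev cellularGroup (k : ℕ) : ModuleCat.{u} ℤ := relHomology (skeletonBelow_mono C k) k

/-- The cellular boundary map `H_{k+1}(E^{k+1}, E^k) ⟶ H_k(E^k) ⟶ H_k(E^k, E^{k-1})`. -/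
def cellularBoundary (k : ℕ) : cellularGroup C (k + 1) ⟶ cellularGroup C k :=
  tripleBoundary (skeletonBelow_mono C k) (skeletonBelow_mono C (k + 1)) k

lemma cellularBoundary_comp (k : ℕ) :
    cellularBoundary C (k + 1) ≫ cellularBoundary C k = 0 :=
  tripleBoundary_comp _ _ _ _

/-- The map `H_k(ē_α, ∂e_α) ⟶ H_k(E^k, E^{k-1})` induced by the inclusion of a closed cell. -/
def cellInclusion (k : ℕ) (α : Topology.RelCWComplex.cell C k) :
    relHomology (Topology.RelCWComplex.cellFrontier_subset_closedCell (C := C) k α) k ⟶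
      cellularGroup C k :=
  relHomologyMap _ _ (Topology.CWComplex.cellFrontier_subset_skeletonLT k α)
    (closedCell_subset_skeletonBelow C k α) k

/-- A choice of orientations of the cells: for every `k`-cell `α` a class
`e_α ∈ H_k(E^k, E^{k-1}; ℤ)` coming from `H_k(ē_α, ∂e_α; ℤ) ≅ ℤ`, such that the classes `e_α` form a
basis of the free abelian group `H_k(E^k, E^{k-1}; ℤ)` (so that `e_α` is the image of a generator).
Changing the orientation of a cell replaces `e_α` by `-e_α`. -/
structure CellOrientation where
  /-- The basis `(e_α)` of the cellular chain group. -/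
  basis (k : ℕ) : Module.Basis (Topology.RelCWComplex.cell C k) ℤ (cellularGroup C k)
  /-- The class `e_α` comes from the closed cell `α`. -/
  basis_mem_range (k : ℕ) (α : Topology.RelCWComplex.cell C k) :
    basis k α ∈ LinearMap.range (cellInclusion C k α).hom

variable {C}

namespace CellOrientation

variable (o : CellOrientation C)

/-- The incidence number `d_{αβ}` of a `(k + 1)`-cell `α` and a `k`-cell `β`: the coefficient of
`e_β` in the cellular boundary of `e_α` (equivalently, the degree of the attaching map of `α`
followed by the collapse onto `β`). -/
def incidence (k : ℕ) (α : Topology.RelCWComplex.cell C (k + 1))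
    (β : Topology.RelCWComplex.cell C k) : ℤ :=
  (o.basis k).repr ((cellularBoundary C k).hom (o.basis (k + 1) α)) β

/-- Every cell occurs in the boundary of only finitely many cells. -/
def IsLocallyFinite : Prop :=
  ∀ (k : ℕ) (β : Topology.RelCWComplex.cell C k),
    {α : Topology.RelCWComplex.cell C (k + 1) | o.incidence k α β ≠ 0}.Finite

/-- The incidence number of two arbitrary cells, zero unless the dimensions are consecutive. -/
def totalIncidence (α β : Σ k, Topology.RelCWComplex.cell C k) : ℤ :=
  if h : α.1 = β.1 + 1 then o.incidence β.1 (h ▸ α.2) β.2 else 0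

lemma totalIncidence_succ (k : ℕ) (α : Topology.RelCWComplex.cell C (k + 1))
    (β : Topology.RelCWComplex.cell C k) :
    o.totalIncidence ⟨k + 1, α⟩ ⟨k, β⟩ = o.incidence k α β := by
  simp [totalIncidence]

lemma totalIncidence_eq {α β : Σ k, Topology.RelCWComplex.cell C k}
    (h : o.totalIncidence α β ≠ 0) : α.1 = β.1 + 1 := by
  by_contra h0
  exact h (dif_neg h0)

lemma sum_incidence_mul (k : ℕ) (α : Topology.RelCWComplex.cell C (k + 1 + 1))
    (γ : Topology.RelCWComplex.cell C k) :
    ∑ᶠ β, o.incidence (k + 1) α β * o.incidence k β γ = 0 := by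
  have h0 : (cellularBoundary C k).hom ((cellularBoundary C (k + 1)).hom (o.basis _ α)) = 0 := by
    have h := congrArg (fun f => f.hom (o.basis _ α)) (cellularBoundary_comp C k)
    simpa using h
  exact finsum_repr_mul (o.basis (k + 1)) (o.basis k) _ _ h0 γ

/-- The cells of a locally finite CW complex and their incidence numbers. -/
def cellularData (ho : o.IsLocallyFinite) : CellularData.{u} where
  cell := Σ k, Topology.RelCWComplex.cell C k
  dim α := α.1
  incidence := o.totalIncidence
  dim_eq _ _ h := o.totalIncidence_eq h
  finite_faces α := by
    obtain ⟨k, α⟩ := α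
    rcases k with _ | k
    · refine Set.finite_empty.subset fun β hβ => ?_
      have := o.totalIncidence_eq hβ
      simp at this
    · refine (((o.basis k).repr ((cellularBoundary C k).hom
        (o.basis (k + 1) α))).hasFiniteSupport.image (Sigma.mk k)).subset ?_
      rintro ⟨j, β⟩ hβ
      have hj : k + 1 = j + 1 := o.totalIncidence_eq hβ
      obtain rfl : k = j := by omega
      refine ⟨β, fun h0 => hβ ?_, rfl⟩
      exact (o.totalIncidence_succ k α β).trans h0
  finite_cofaces β := by
    obtain ⟨k, β⟩ := β
    refine ((ho k β).image (Sigma.mk (k + 1))).subset ?_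
    rintro ⟨j, α⟩ hα
    obtain rfl : j = k + 1 := o.totalIncidence_eq hα
    refine ⟨α, fun h0 => hα ?_, rfl⟩
    exact (o.totalIncidence_succ k α β).trans h0
  incidence_comp α γ := by
    obtain ⟨j, α⟩ := α
    obtain ⟨k, γ⟩ := γ
    by_cases hj : j = k + 1 + 1
    · subst hj
      rw [← o.sum_incidence_mul k α γ]
      have h1 : Function.support (fun β => o.totalIncidence ⟨k + 1 + 1, α⟩ β *
          o.totalIncidence β ⟨k, γ⟩) ⊆ Set.range (Sigma.mk (k + 1)) := by
        rintro ⟨j, β⟩ hβ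
        obtain rfl : j = k + 1 := o.totalIncidence_eq (right_ne_zero_of_mul hβ)
        exact ⟨β, rfl⟩
      rw [← finsum_mem_univ, ← finsum_mem_inter_support, Set.univ_inter,
        ← Set.inter_eq_right.2 h1, finsum_mem_inter_support,
        finsum_mem_range sigma_mk_injective]
      simp only [totalIncidence_succ]
    · refine finsum_eq_zero_of_forall_eq_zero fun β => ?_
      by_contra h0
      have h1 := o.totalIncidence_eq (left_ne_zero_of_mul h0)
      have h2 := o.totalIncidence_eq (right_ne_zero_of_mul h0)
      exact hj (h1.trans (by rw [h2]))

end CellOrientation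

end CW

/-! ### The quasi-local algebra and its string automorphisms -/

/-- The character `x ↦ e^{2πix}` of `ℚ/ℤ`. -/
def expQZ : AddCircle (1 : ℚ) →+ Additive Circle :=
  QuotientAddGroup.lift (AddSubgroup.zmultiples (1 : ℚ))
    (Circle.expHom.comp ((AddMonoidHom.mulLeft (2 * Real.pi)).comp ((Rat.castHom ℝ : ℚ →+* ℝ).toAddMonoidHom)))
    (by
      intro x hx
      obtain ⟨k, rfl⟩ := AddSubgroup.mem_zmultiples_iff.1 hx
      have h : Circle.exp (2 * Real.pi * ((k : ℤ) : ℝ)) = 1 := by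
        rw [mul_comm]
        exact Circle.exp_int_mul_two_pi k
      have h' : k • (1 : ℚ) = (k : ℚ) := by simp
      rw [h', AddMonoidHom.mem_ker]
      change Additive.ofMul (Circle.exp (2 * Real.pi * (((k : ℚ) : ℚ) : ℝ))) = 0
      rw [Rat.cast_intCast, h]
      rfl)

/-- `e^{2πix}` as a point of the unit circle. -/
def cis (x : AddCircle (1 : ℚ)) : Circle := (expQZ x).toMul

lemma cis_add (x y : AddCircle (1 : ℚ)) : cis (x + y) = cis x * cis y := by
  simp [cis]

lemma cis_zero : cis 0 = 1 := by simp [cis]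

lemma cis_coe (q : ℚ) : (cis (q : AddCircle (1 : ℚ)) : ℂ) = Complex.exp (2 * Real.pi * Complex.I * q) := by
  have : cis (q : AddCircle (1 : ℚ)) = Circle.exp (2 * Real.pi * (q : ℝ)) := rfl
  rw [this, Circle.coe_exp]
  congr 1
  push_cast
  ring

section QuasiLocal

variable (S : Type u) (G : Type v)

/-- The Hilbert space `ℓ²` of the finitely supported configurations `S → G`. Its basis vectors are the
configurations `|h⟩`; it is the infinite tensor product of copies of `ℓ²(G)` along the vectors `|0⟩`,
on which all local observables act faithfully. -/
abbrev ConfigSpace [Zero G] := lp (fun _ : S →₀ G => ℂ) 2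

variable {S G}

lemma memℓp_monomial {I : Type*} (e : I ≃ I) (c : I → Circle) (ψ : lp (fun _ : I => ℂ) 2) :
    Memℓp (fun h => (c h : ℂ) * ψ (e h)) 2 := by
  refine memℓp_gen ?_
  have h := (lp.memℓp ψ).summable (by norm_num)
  simpa [norm_mul, Circle.norm_coe, Function.comp_def] using (e.summable_iff).2 h

/-- The unitary `ψ ↦ (h ↦ c(h) ψ(e h))` of `ℓ²(I)`. -/
def monomialIso {I : Type*} (e : I ≃ I) (c : I → Circle) :
    lp (fun _ : I => ℂ) 2 ≃ₗᵢ[ℂ] lp (fun _ : I => ℂ) 2 where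
  toFun ψ := ⟨fun h => (c h : ℂ) * ψ (e h), memℓp_monomial e c ψ⟩
  invFun ψ := ⟨fun h => (((c (e.symm h))⁻¹ : Circle) : ℂ) * ψ (e.symm h),
    memℓp_monomial e.symm (fun h => (c (e.symm h))⁻¹) ψ⟩
  map_add' ψ φ := by ext h; exact mul_add _ _ _
  map_smul' a ψ := by ext h; exact mul_left_comm _ _ _
  left_inv ψ := by ext h; simp
  right_inv ψ := by ext h; simp
  norm_map' ψ := by
    rw [lp.norm_eq_tsum_rpow (by norm_num), lp.norm_eq_tsum_rpow (by norm_num)]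
    congr 1
    simpa [norm_mul, Circle.norm_coe] using e.tsum_eq (fun h => ‖ψ h‖ ^ (2 : ENNReal).toReal)

variable [AddCommGroup G]

open Classical in
/-- The configuration `h` with its values on `Λ` replaced by those of `k`. -/
def replaceOn (h : S →₀ G) (Λ : Finset S) (k : Λ → G) : S →₀ G :=
  Finsupp.indicator Λ (fun s hs => k ⟨s, hs⟩) + h.filter (· ∉ Λ)

lemma replaceOn_apply_mem (h : S →₀ G) (Λ : Finset S) (k : Λ → G) {s : S} (hs : s ∈ Λ) :
    replaceOn h Λ k s = k ⟨s, hs⟩ := by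
  simp [replaceOn, hs, Finsupp.indicator_of_mem hs]

lemma replaceOn_apply_not_mem (h : S →₀ G) (Λ : Finset S) (k : Λ → G) {s : S} (hs : s ∉ Λ) :
    replaceOn h Λ k s = h s := by
  simp [replaceOn, hs, Finsupp.indicator_of_notMem hs]

/-- The algebra `𝔄_Λ = B(ℓ²(G)^{⊗Λ})` of observables supported on the finite set `Λ`: the operators
`M ⊗ 1` where `M` is a matrix indexed by the configurations on `Λ`. -/
def localOperators (Λ : Finset S) : Set (ConfigSpace S G →L[ℂ] ConfigSpace S G) :=
  {T | ∃ M : (Λ → G) → (Λ → G) → ℂ, ∀ (ψ : ConfigSpace S G) (h : S →₀ G),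
    T ψ h = ∑ᶠ k : Λ → G, M (fun s => h s) k * ψ (replaceOn h Λ k)}

variable (S G) in
/-- The norm closure of the algebra of local operators. -/
def quasiLocalAlgebra : StarSubalgebra ℂ (ConfigSpace S G →L[ℂ] ConfigSpace S G) :=
  (StarAlgebra.adjoin ℂ (⋃ Λ : Finset S, localOperators Λ)).topologicalClosure

variable (S G) in
/-- The quasi-local algebra of the system with a copy of `ℓ²(G)` at every site `s ∈ S`, the C*-algebra
direct limit of the algebras `B(ℓ²(G)^{⊗Λ})` for finite `Λ ⊆ S`, realized as the norm closure of their
union. -/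
def QuasiLocal : Type (max u v) := quasiLocalAlgebra S G

instance : CompleteSpace (quasiLocalAlgebra S G) :=
  (StarSubalgebra.isClosed_topologicalClosure _).completeSpace_coe

instance : CStarAlgebra (quasiLocalAlgebra S G) where

instance : CStarAlgebra (QuasiLocal S G) :=
  inferInstanceAs (CStarAlgebra (quasiLocalAlgebra S G))

instance : PartialOrder (QuasiLocal S G) := CStarAlgebra.spectralOrder _

instance : StarOrderedRing (QuasiLocal S G) := CStarAlgebra.spectralOrderedRing _

/-- The inclusion of the quasi-local algebra in the algebra of all bounded operators. -/
def QuasiLocal.toOp : QuasiLocal S G →⋆ₐ[ℂ] (ConfigSpace S G →L[ℂ] ConfigSpace S G) :=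
  (quasiLocalAlgebra S G).subtype

lemma localOperators_subset (Λ : Finset S) :
    (localOperators Λ : Set (ConfigSpace S G →L[ℂ] ConfigSpace S G)) ⊆ quasiLocalAlgebra S G :=
  fun _ hT => StarSubalgebra.le_topologicalClosure _
    (StarAlgebra.subset_adjoin ℂ _ (Set.mem_iUnion.2 ⟨Λ, hT⟩))

/-- The operator `X^a |h⟩ = |a + h⟩`. -/
def pauliXIso (a : S →₀ G) : ConfigSpace S G ≃ₗᵢ[ℂ] ConfigSpace S G :=
  monomialIso (Equiv.subRight a) 1

/-- The operator `Z^b |h⟩ = e^{2πi ∑_s b_s(h_s)} |h⟩`. -/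
def pauliZIso (b : S →₀ (G →+ AddCircle (1 : ℚ))) : ConfigSpace S G ≃ₗᵢ[ℂ] ConfigSpace S G :=
  monomialIso (Equiv.refl _) (fun h => cis (b.sum fun s χ => χ (h s)))

lemma pauliXIso_apply (a : S →₀ G) (ψ : ConfigSpace S G) (h : S →₀ G) :
    pauliXIso a ψ h = ψ (h - a) := by
  simp [pauliXIso, monomialIso]

lemma pauliZIso_apply (b : S →₀ (G →+ AddCircle (1 : ℚ))) (ψ : ConfigSpace S G) (h : S →₀ G) :
    pauliZIso b ψ h = cis (b.sum fun s χ => χ (h s)) * ψ h := by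
  simp [pauliZIso, monomialIso]

lemma pauliXIso_mem (a : S →₀ G) :
    ((pauliXIso a : ConfigSpace S G ≃ₗᵢ[ℂ] ConfigSpace S G) :
      ConfigSpace S G →L[ℂ] ConfigSpace S G) ∈ localOperators a.support := by
  classical
  refine ⟨fun h k => if k = (fun s => h s - a s) then 1 else 0, fun ψ h => ?_⟩
  rw [finsum_eq_single _ (fun s : a.support => h s - a s)]
  · simp only [if_true, one_mul]
    refine (pauliXIso_apply a ψ h).trans ?_
    refine congrArg (fun x => (ψ x : ℂ)) ?_
    ext s
    by_cases hs : s ∈ a.support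
    · rw [replaceOn_apply_mem _ _ _ hs]; simp
    · rw [replaceOn_apply_not_mem _ _ _ hs]
      simp [Finsupp.notMem_support_iff.1 hs]
  · intro k hk
    simp [hk]

lemma pauliZIso_mem (b : S →₀ (G →+ AddCircle (1 : ℚ))) :
    ((pauliZIso b : ConfigSpace S G ≃ₗᵢ[ℂ] ConfigSpace S G) :
      ConfigSpace S G →L[ℂ] ConfigSpace S G) ∈ localOperators b.support := by
  classical
  refine ⟨fun h k => if k = h then cis (∑ s : b.support, b s (h s)) else 0, fun ψ h => ?_⟩
  rw [finsum_eq_single _ (fun s : b.support => h s)]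
  · simp only [if_true]
    refine (pauliZIso_apply b ψ h).trans ?_
    rw [Finsupp.sum, ← Finset.sum_coe_sort]
    refine congrArg (fun x => _ * (ψ x : ℂ)) ?_
    · ext s
      by_cases hs : s ∈ b.support
      · rw [replaceOn_apply_mem _ _ _ hs]
      · rw [replaceOn_apply_not_mem _ _ _ hs]
  · intro k hk
    simp [hk]

/-- A unitary operator lying in the algebra, as a unitary element of it. -/
def toUnitary (U : ConfigSpace S G ≃ₗᵢ[ℂ] ConfigSpace S G)
    (hU : (U : ConfigSpace S G →L[ℂ] ConfigSpace S G) ∈ quasiLocalAlgebra S G) :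
    unitary (QuasiLocal S G) :=
  ⟨⟨U, hU⟩, by
    have h := (Unitary.linearIsometryEquiv.symm U).2
    rw [Unitary.coe_symm_linearIsometryEquiv_apply] at h
    exact ⟨Subtype.ext h.1, Subtype.ext h.2⟩⟩

/-- The observable `X^a = ∏_s (X^{a_s})_s`. -/
def pauliX (a : S →₀ G) : unitary (QuasiLocal S G) :=
  toUnitary (pauliXIso a) (localOperators_subset _ (pauliXIso_mem a))

/-- The observable `Z^b = ∏_s (Z^{b_s})_s`. -/
def pauliZ (b : S →₀ (G →+ AddCircle (1 : ℚ))) : unitary (QuasiLocal S G) :=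
  toUnitary (pauliZIso b) (localOperators_subset _ (pauliZIso_mem b))

/-- Conjugation `A ↦ U A U^*` of operators by a unitary operator. -/
abbrev conjOp (U : ConfigSpace S G ≃ₗᵢ[ℂ] ConfigSpace S G) :
    (ConfigSpace S G →L[ℂ] ConfigSpace S G) ≃⋆ₐ[ℂ] (ConfigSpace S G →L[ℂ] ConfigSpace S G) :=
  U.conjStarAlgEquiv

lemma norm_conjOp_sub_le (U : ConfigSpace S G ≃ₗᵢ[ℂ] ConfigSpace S G)
    (A B : ConfigSpace S G →L[ℂ] ConfigSpace S G) : ‖conjOp U A - conjOp U B‖ ≤ ‖A - B‖ := by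
  rw [← map_sub]
  refine ContinuousLinearMap.opNorm_le_bound _ (norm_nonneg _) fun ψ => ?_
  rw [LinearIsometryEquiv.conjStarAlgEquiv_apply_apply, LinearIsometryEquiv.norm_map]
  simpa using (A - B).le_opNorm (U.symm ψ)

lemma toOp_toUnitary_conj (U : ConfigSpace S G ≃ₗᵢ[ℂ] ConfigSpace S G)
    (hU : (U : ConfigSpace S G →L[ℂ] ConfigSpace S G) ∈ quasiLocalAlgebra S G)
    (A : QuasiLocal S G) :
    QuasiLocal.toOp ((toUnitary U hU : QuasiLocal S G) * A * star (toUnitary U hU : QuasiLocal S G))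
      = conjOp U (QuasiLocal.toOp A) := by
  rw [map_mul, map_mul, map_star]
  have : QuasiLocal.toOp (toUnitary U hU : QuasiLocal S G) =
      (U : ConfigSpace S G →L[ℂ] ConfigSpace S G) := rfl
  rw [this, LinearIsometryEquiv.star_eq_symm]
  rfl

open Classical in
/-- If conjugation by a net of unitaries is eventually constant on each local operator, it
converges in norm on the whole quasi-local algebra. -/
lemma exists_tendsto_conjOp (U : Finset S → ConfigSpace S G ≃ₗᵢ[ℂ] ConfigSpace S G)
    (h : ∀ Λ : Finset S, ∀ T ∈ (localOperators Λ : Set (ConfigSpace S G →L[ℂ] ConfigSpace S G)),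
      ∃ B, ∀ᶠ K in atTop, conjOp (U K) T = B)
    (A : ConfigSpace S G →L[ℂ] ConfigSpace S G) (hA : A ∈ quasiLocalAlgebra S G) :
    ∃ B, Tendsto (fun K => conjOp (U K) A) atTop (𝓝 B) := by
  have hadj : ∀ T ∈ StarAlgebra.adjoin ℂ (⋃ Λ : Finset S,
      (localOperators Λ : Set (ConfigSpace S G →L[ℂ] ConfigSpace S G))),
      ∃ B, Tendsto (fun K => conjOp (U K) T) atTop (𝓝 B) := by
    intro T hT
    induction hT using StarAlgebra.adjoin_induction with
    | mem x hx =>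
      obtain ⟨Λ, hx⟩ := Set.mem_iUnion.1 hx
      obtain ⟨B, hB⟩ := h Λ x hx
      exact ⟨B, tendsto_const_nhds.congr' (hB.mono fun K hK => hK.symm)⟩
    | algebraMap r =>
      refine ⟨algebraMap ℂ _ r, tendsto_const_nhds.congr fun K => ?_⟩
      exact (AlgHomClass.commutes (conjOp (U K)) r).symm
    | add x y _ _ hx hy =>
      obtain ⟨B, hB⟩ := hx
      obtain ⟨B', hB'⟩ := hy
      exact ⟨B + B', (hB.add hB').congr fun K => (map_add (conjOp (U K)) x y).symm⟩
    | mul x y _ _ hx hy =>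
      obtain ⟨B, hB⟩ := hx
      obtain ⟨B', hB'⟩ := hy
      exact ⟨B * B', (hB.mul hB').congr fun K => (map_mul (conjOp (U K)) x y).symm⟩
    | star x _ hx =>
      obtain ⟨B, hB⟩ := hx
      exact ⟨star B, hB.star.congr fun K => (map_star (conjOp (U K)) x).symm⟩
  apply cauchySeq_tendsto_of_complete
  rw [Metric.cauchySeq_iff']
  intro ε hε
  have hA' : A ∈ closure ((StarAlgebra.adjoin ℂ (⋃ Λ : Finset S,
      (localOperators Λ : Set (ConfigSpace S G →L[ℂ] ConfigSpace S G))) :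
        StarSubalgebra ℂ (ConfigSpace S G →L[ℂ] ConfigSpace S G)) :
        Set (ConfigSpace S G →L[ℂ] ConfigSpace S G)) := hA
  obtain ⟨T, hT, hAT⟩ := Metric.mem_closure_iff.1 hA' (ε / 3) (by positivity)
  obtain ⟨B, hB⟩ := hadj T hT
  obtain ⟨N, hN⟩ := Metric.cauchySeq_iff'.1 hB.cauchySeq (ε / 3) (by positivity)
  refine ⟨N, fun K hK => ?_⟩
  have h1 := norm_conjOp_sub_le (U K) A T
  have h2 := norm_conjOp_sub_le (U N) T A
  have h3 := hN K hK
  rw [dist_eq_norm] at h3 hAT ⊢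
  have h4 : ‖T - A‖ < ε / 3 := by rwa [norm_sub_rev]
  calc ‖conjOp (U K) A - conjOp (U N) A‖
      = ‖(conjOp (U K) A - conjOp (U K) T) + (conjOp (U K) T - conjOp (U N) T)
          + (conjOp (U N) T - conjOp (U N) A)‖ := by congr 1; abel
    _ ≤ _ := norm_add₃_le
    _ < ε := by linarith

/-- The limit in norm `A ↦ lim_K W_K A W_K^*` of a net of inner automorphisms that converges
at every point. -/
def limitConj (W : Finset S → unitary (QuasiLocal S G))
    (h : ∀ A : QuasiLocal S G, ∃ B : QuasiLocal S G,
      Tendsto (fun K => (W K : QuasiLocal S G) * A * star (W K : QuasiLocal S G)) atTop (𝓝 B)) :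
    QuasiLocal S G →⋆ₐ[ℂ] QuasiLocal S G := by
  classical
  have ht : ∀ A, Tendsto (fun K => (W K : QuasiLocal S G) * A * star (W K : QuasiLocal S G)) atTop
      (𝓝 (limUnder atTop
        fun K => (W K : QuasiLocal S G) * A * star (W K : QuasiLocal S G))) :=
    fun A => tendsto_nhds_limUnder (h A)
  exact
  { toFun := fun A => limUnder atTop
      fun K => (W K : QuasiLocal S G) * A * star (W K : QuasiLocal S G)
    map_one' := by
      refine tendsto_nhds_unique (ht 1) (tendsto_const_nhds.congr fun K => ?_)
      simp
    map_mul' := fun A B => by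
      refine tendsto_nhds_unique (ht (A * B)) (((ht A).mul (ht B)).congr fun K => ?_)
      exact (map_mul (Unitary.conjStarAlgAut ℂ (QuasiLocal S G) (W K)) A B).symm
    map_zero' := by
      refine tendsto_nhds_unique (ht 0) (tendsto_const_nhds.congr fun K => ?_)
      simp
    map_add' := fun A B => by
      refine tendsto_nhds_unique (ht (A + B)) (((ht A).add (ht B)).congr fun K => ?_)
      exact (map_add (Unitary.conjStarAlgAut ℂ (QuasiLocal S G) (W K)) A B).symm
    commutes' := fun r => by
      refine tendsto_nhds_unique (ht _) (tendsto_const_nhds.congr fun K => ?_)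
      exact (AlgHomClass.commutes (Unitary.conjStarAlgAut ℂ (QuasiLocal S G) (W K)) r).symm
    map_star' := fun A => by
      refine tendsto_nhds_unique (ht (star A)) ((ht A).star.congr fun K => ?_)
      exact (map_star (Unitary.conjStarAlgAut ℂ (QuasiLocal S G) (W K)) A).symm }

lemma limitConj_apply (W : Finset S → unitary (QuasiLocal S G)) (h) (A : QuasiLocal S G) :
    limitConj W h A =
      limUnder atTop fun K => (W K : QuasiLocal S G) * A * star (W K : QuasiLocal S G) := rfl

lemma exists_tendsto_toUnitary_conj (U : Finset S → ConfigSpace S G ≃ₗᵢ[ℂ] ConfigSpace S G)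
    (hU : ∀ K, (U K : ConfigSpace S G →L[ℂ] ConfigSpace S G) ∈ quasiLocalAlgebra S G)
    (h : ∀ Λ : Finset S, ∀ T ∈ (localOperators Λ : Set (ConfigSpace S G →L[ℂ] ConfigSpace S G)),
      ∃ B, ∀ᶠ K in atTop, conjOp (U K) T = B) (A : QuasiLocal S G) :
    ∃ B : QuasiLocal S G, Tendsto (fun K => (toUnitary (U K) (hU K) : QuasiLocal S G) * A *
      star (toUnitary (U K) (hU K) : QuasiLocal S G)) atTop (𝓝 B) := by
  classical
  obtain ⟨B, hB⟩ := exists_tendsto_conjOp U h (QuasiLocal.toOp A) A.2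
  have hB' : Tendsto (fun K => QuasiLocal.toOp ((toUnitary (U K) (hU K) : QuasiLocal S G) * A *
      star (toUnitary (U K) (hU K) : QuasiLocal S G))) atTop (𝓝 B) :=
    hB.congr fun K => (toOp_toUnitary_conj _ _ _).symm
  have hmem : B ∈ quasiLocalAlgebra S G :=
    (StarSubalgebra.isClosed_topologicalClosure _).mem_of_tendsto hB'
      (Eventually.of_forall fun K => Subtype.property _)
  exact ⟨⟨B, hmem⟩, tendsto_subtype_rng.2 hB'⟩

/-- The restriction of a function to a finite set `K` of sites. -/
def truncate {A : Type*} [Zero A] (K : Finset S) (x : S → A) : S →₀ A :=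
  Finsupp.indicator K fun s _ => x s

lemma eventually_conjOp_pauliXIso (δ : S → G) (Λ : Finset S)
    (T : ConfigSpace S G →L[ℂ] ConfigSpace S G) (hT : T ∈ localOperators Λ) :
    ∃ B, ∀ᶠ K in atTop, conjOp (pauliXIso (truncate K δ)) T = B := by
  classical
  refine ⟨conjOp (pauliXIso (truncate Λ δ)) T, eventually_atTop.2 ⟨Λ, fun K hK => ?_⟩⟩
  obtain ⟨M, hM⟩ := hT
  have key : ∀ K : Finset S, Λ ⊆ K → ∀ (ψ : ConfigSpace S G) (h : S →₀ G),
      conjOp (pauliXIso (truncate K δ)) T ψ h =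
        ∑ᶠ k : Λ → G, M (fun s => h s - δ s) k * ψ (replaceOn h Λ fun s => k s + δ s) := by
    intro K hK ψ h
    rw [LinearIsometryEquiv.conjStarAlgEquiv_apply_apply, pauliXIso_apply, hM]
    refine finsum_congr fun k => ?_
    have h1 : (fun s : Λ => (h - truncate K δ) s) = fun s : Λ => h s - δ s := by
      funext s
      simp [truncate, Finsupp.indicator_of_mem (hK s.2)]
    rw [h1]
    have h2 : ∀ φ : ConfigSpace S G, ∀ g : S →₀ G,
        (pauliXIso (truncate K δ)).symm φ g = φ (g + truncate K δ) := by
      intro φ g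
      conv_rhs => rw [← (pauliXIso (truncate K δ)).apply_symm_apply φ]
      rw [pauliXIso_apply, add_sub_cancel_right]
    rw [h2]
    refine congrArg (fun x => _ * (ψ x : ℂ)) ?_
    ext s
    by_cases hs : s ∈ Λ
    · rw [Finsupp.add_apply, replaceOn_apply_mem _ _ _ hs, replaceOn_apply_mem _ _ _ hs]
      simp [truncate, Finsupp.indicator_of_mem (hK hs)]
    · rw [Finsupp.add_apply, replaceOn_apply_not_mem _ _ _ hs, replaceOn_apply_not_mem _ _ _ hs]
      simp
  ext ψ h
  rw [key K hK, key Λ subset_rfl]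

lemma eventually_conjOp_pauliZIso (γ : S → G →+ AddCircle (1 : ℚ)) (Λ : Finset S)
    (T : ConfigSpace S G →L[ℂ] ConfigSpace S G) (hT : T ∈ localOperators Λ) :
    ∃ B, ∀ᶠ K in atTop, conjOp (pauliZIso (truncate K γ)) T = B := by
  classical
  refine ⟨conjOp (pauliZIso (truncate Λ γ)) T, eventually_atTop.2 ⟨Λ, fun K hK => ?_⟩⟩
  obtain ⟨M, hM⟩ := hT
  have hsum : ∀ (K : Finset S) (h : S →₀ G),
      ((truncate K γ).sum fun s χ => χ (h s)) = ∑ s ∈ K, γ s (h s) := by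
    intro K h
    rw [truncate, Finsupp.sum_indicator_index]
    simp
  have key : ∀ K : Finset S, Λ ⊆ K → ∀ (ψ : ConfigSpace S G) (h : S →₀ G),
      conjOp (pauliZIso (truncate K γ)) T ψ h =
        ∑ᶠ k : Λ → G, M (fun s => h s) k *
          ((cis (∑ s : Λ, γ s (h s - k s)) : ℂ) * ψ (replaceOn h Λ k)) := by
    intro K hK ψ h
    rw [LinearIsometryEquiv.conjStarAlgEquiv_apply_apply, pauliZIso_apply, hM, ← smul_eq_mul,
      smul_finsum]
    refine finsum_congr fun k => ?_
    have h2 : ∀ φ : ConfigSpace S G, ∀ g : S →₀ G,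
        (cis ((truncate K γ).sum fun s χ => χ (g s)) : ℂ) *
          (pauliZIso (truncate K γ)).symm φ g = φ g := by
      intro φ g
      conv_rhs => rw [← (pauliZIso (truncate K γ)).apply_symm_apply φ]
      rw [pauliZIso_apply]
    have h3 : ((truncate K γ).sum fun s χ => χ (h s)) =
        (∑ s : Λ, γ s (h s - k s)) +
          (truncate K γ).sum fun s χ => χ (replaceOn h Λ k s) := by
      rw [hsum, hsum, ← sub_eq_iff_eq_add, ← Finset.sum_sub_distrib,
        ← Finset.sum_subset hK (fun s _ hs => by
          rw [replaceOn_apply_not_mem _ _ _ hs, sub_self]), ← Finset.sum_coe_sort]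
      refine Finset.sum_congr rfl fun s _ => ?_
      rw [replaceOn_apply_mem _ _ _ s.2, ← map_sub]
    rw [← h2 ψ (replaceOn h Λ k), h3, cis_add, Circle.coe_mul, smul_eq_mul]
    ring
  ext ψ h
  rw [key K hK, key Λ subset_rfl]

/-- The endomorphism `ρ_δ(A) = lim_K X^{δ_K} A X^{-δ_K}` (a limit in norm over the finite sets `K` of
sites). -/
def rhoX (δ : S → G) : QuasiLocal S G →⋆ₐ[ℂ] QuasiLocal S G :=
  limitConj (fun K => pauliX (truncate K δ))
    (exists_tendsto_toUnitary_conj _ _ (eventually_conjOp_pauliXIso δ))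

/-- The endomorphism `ρ_γ(A) = lim_K Z^{γ_K} A Z^{-γ_K}` (a limit in norm over the finite sets `K` of
sites). -/
def rhoZ (γ : S → G →+ AddCircle (1 : ℚ)) : QuasiLocal S G →⋆ₐ[ℂ] QuasiLocal S G :=
  limitConj (fun K => pauliZ (truncate K γ))
    (exists_tendsto_toUnitary_conj _ _ (eventually_conjOp_pauliZIso γ))

end QuasiLocal

/-! ### The model, asymptotic ground states and their polarization -/

namespace CellularData

variable (E : CellularData.{u})

/-- The set `𝓔_i` of cells of dimension `i ∈ ℤ` (empty for negative `i`). -/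
abbrev CellsOfDim (i : ℤ) : Type u := {α : E.cell // (E.dim α : ℤ) = i}

/-- The algebra of observables: the quasi-local algebra with a copy of `ℓ²(G)` at every
`n`-cell. -/
abbrev Observables (G : Type v) [AddCommGroup G] (n : ℕ) : Type (max u v) :=
  QuasiLocal (E.CellsOfDim n) G

section Restriction

variable {A : Type v} [AddCommGroup A]

/-- A chain or cochain of finite support in degree `n`, regarded as a finitely supported function on
the set of `n`-cells. -/
def onCells (n : ℕ) (x : E.cell → A) (hx : x.support.Finite) : E.CellsOfDim n →₀ A :=
  Finsupp.ofSupportFinite (fun σ => x σ.1) (hx.preimage Subtype.val_injective.injOn)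

/-- The part `x_K` of a chain or cochain `x` supported on a finite set `K` of `i`-cells. -/
def restrictTo {i : ℤ} (K : Finset (E.CellsOfDim i)) (x : E.cell → A) : E.cell → A :=
  Set.indicator (Subtype.val '' (K : Set (E.CellsOfDim i))) x

lemma finite_support_restrictTo {i : ℤ} (K : Finset (E.CellsOfDim i)) (x : E.cell → A) :
    (E.restrictTo K x).support.Finite :=
  (K.finite_toSet.image _).subset Set.support_indicator_subset

lemma finite_support_boundary_sub {i : ℤ} (K : Finset (E.CellsOfDim i)) {x : E.cell → A}
    (hx : (E.boundary A x).support.Finite) :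
    (E.boundary A (x - E.restrictTo K x)).support.Finite := by
  rw [map_sub]
  exact (hx.union (E.finite_support_boundary (E.finite_support_restrictTo K x))).subset
    (Function.support_sub _ _)

lemma finite_support_coboundary_sub {i : ℤ} (K : Finset (E.CellsOfDim i)) {x : E.cell → A}
    (hx : (E.coboundary A x).support.Finite) :
    (E.coboundary A (x - E.restrictTo K x)).support.Finite := by
  rw [map_sub]
  exact (hx.union (E.finite_support_coboundary (E.finite_support_restrictTo K x))).subset
    (Function.support_sub _ _)

end Restriction

variable {G : Type v} [AddCommGroup G]

/-- The observable `X^{∂ᵀc} Z^{∂d}`, for `∂ᵀc` and `∂d` of finite support. -/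
def groundObservable (n : ℕ) (c : E.cell → G) (hc : (E.coboundary G c).support.Finite)
    (d : E.cell → G →+ AddCircle (1 : ℚ)) (hd : (E.boundary _ d).support.Finite) :
    E.Observables G n :=
  (pauliX (E.onCells n (E.coboundary G c) hc) : E.Observables G n) *
    (pauliZ (E.onCells n (E.boundary _ d) hd) : E.Observables G n)

/-- A positive linear functional `ω` is an asymptotic ground state if it is a state and for every
`ε > 0` there are finite sets `K₋`, `K₊` of `(n - 1)`- and `(n + 1)`-cells such that
`|ω(X^{∂ᵀc} Z^{∂d}) - 1| < ε` for all finite `c`, `d` supported off `K₋`, `K₊`. -/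
def IsAsymptoticGroundState (n : ℕ) (ω : E.Observables G n →ₚ[ℂ] ℂ) : Prop :=
  ω 1 = 1 ∧ ∀ ε : ℝ, 0 < ε →
    ∃ (Kminus : Finset (E.CellsOfDim (n - 1))) (Kplus : Finset (E.CellsOfDim (n + 1))),
      ∀ (c : E.cell → G) (hc : c ∈ E.finChains G (n - 1))
        (d : E.cell → G →+ AddCircle (1 : ℚ)) (hd : d ∈ E.finChains _ (n + 1)),
        (∀ α ∈ Kminus, c α = 0) → (∀ α ∈ Kplus, d α = 0) →
          ‖ω (E.groundObservable n c (E.finite_support_coboundary hc.2) d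
            (E.finite_support_boundary hd.2)) - 1‖ < ε

/-- The endomorphism `ρ_(γ,δ) = ρ_γ ∘ ρ_δ` of the algebra of observables. -/
def rho (n : ℕ) (γ : E.cell → G →+ AddCircle (1 : ℚ)) (δ : E.cell → G) :
    E.Observables G n →⋆ₐ[ℂ] E.Observables G n :=
  (rhoZ fun σ => γ σ.1).comp (rhoX fun σ => δ σ.1)

/-- The functional `ω ∘ ρ_(γ,δ)`. -/
def compRho (n : ℕ) (ω : E.Observables G n →ₚ[ℂ] ℂ) (γ : E.cell → G →+ AddCircle (1 : ℚ))
    (δ : E.cell → G) : E.Observables G n →ₚ[ℂ] ℂ :=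
  ω.comp (PositiveLinearMap.ofClass (E.rho n γ δ))

lemma compRho_apply (n : ℕ) (ω : E.Observables G n →ₚ[ℂ] ℂ)
    (γ : E.cell → G →+ AddCircle (1 : ℚ)) (δ : E.cell → G) (A : E.Observables G n) :
    E.compRho n ω γ δ A = ω (E.rho n γ δ A) := rfl

variable (G) in
/-- The group `H^∞_n(E; Ĝ) × H_∞^{n-1}(E; G)`, written multiplicatively. -/
abbrev ChargeGroup (n : ℕ) : Type (max u v) :=
  Multiplicative (E.HomologyAtInfinity (G →+ AddCircle (1 : ℚ)) n ×
    E.CohomologyAtInfinity G (n - 1))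

/-- `P` is the polarization of `ω`: the unitary representation of `H^∞_n(E; Ĝ) × H_∞^{n-1}(E; G)` on
the GNS space of `ω` such that `P([d]^∞, [c]_∞)` is the strong limit of
`π_ω(X^{∂ᵀ(c - c_K)} Z^{∂(d - d_L)})` over the finite sets `K`, `L` of `(n - 1)`- and
`(n + 1)`-cells, for all `d` with finite boundary and all `c` with finite coboundary. -/
def IsPolarization (n : ℕ) (ω : E.Observables G n →ₚ[ℂ] ℂ)
    (P : E.ChargeGroup G n →* unitary (ω.GNS →L[ℂ] ω.GNS)) : Prop :=
  ∀ (d : E.cell → G →+ AddCircle (1 : ℚ)) (hd : d ∈ E.chains _ (n + 1))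
    (hd' : (E.boundary _ d).support.Finite)
    (c : E.cell → G) (hc : c ∈ E.chains G (n - 1)) (hc' : (E.coboundary G c).support.Finite)
    (v : ω.GNS),
    Tendsto (fun K : Finset (E.CellsOfDim (n - 1)) × Finset (E.CellsOfDim (n + 1)) =>
        ω.gnsStarAlgHom (E.groundObservable n
          (c - E.restrictTo K.1 c) (E.finite_support_coboundary_sub K.1 hc')
          (d - E.restrictTo K.2 d) (E.finite_support_boundary_sub K.2 hd')) v)
      atTop
      (𝓝 ((P (Multiplicative.ofAdd (E.homologyClass rfl d hd hd', E.cohomologyClass c hc hc')) :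
        ω.GNS →L[ℂ] ω.GNS) v))

lemma exists_homologyClass (i : ℤ) (z : E.HomologyAtInfinity (G →+ AddCircle (1 : ℚ)) i) :
    ∃ d hd hd', z = E.homologyClass (i := i) rfl d hd hd' := by
  obtain ⟨⟨⟨b, d⟩, hz⟩, rfl⟩ := QuotientAddGroup.mk_surjective z
  have h := E.boundary_snd_eq ⟨(b, d), hz⟩
  refine ⟨d, hz.1.2, ?_, ?_⟩
  · rw [h]
    simpa using hz.1.1.2
  · refine congrArg _ (Subtype.ext (Prod.ext ?_ rfl))
    exact (neg_eq_iff_eq_neg.2 h).symm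

lemma exists_cohomologyClass (i : ℤ) (w : E.CohomologyAtInfinity G i) :
    ∃ c hc hc', w = E.cohomologyClass (i := i) c hc hc' := by
  obtain ⟨⟨⟨a, c⟩, hw⟩, rfl⟩ := QuotientAddGroup.mk_surjective w
  have h := E.coboundary_snd_eq ⟨(a, c), hw⟩
  refine ⟨c, hw.1.2, ?_, ?_⟩
  · rw [h]
    simpa using hw.1.1.2
  · refine congrArg _ (Subtype.ext (Prod.ext ?_ rfl))
    exact (neg_eq_iff_eq_neg.2 h).symm

/-- A functional has at most one polarization. -/
lemma IsPolarization.unique {n : ℕ} {ω : E.Observables G n →ₚ[ℂ] ℂ}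
    {P Q : E.ChargeGroup G n →* unitary (ω.GNS →L[ℂ] ω.GNS)}
    (hP : E.IsPolarization n ω P) (hQ : E.IsPolarization n ω Q) : P = Q := by
  classical
  ext x v
  obtain ⟨d, hd, hd', h1⟩ := E.exists_homologyClass _ (Multiplicative.toAdd x).1
  obtain ⟨c, hc, hc', h2⟩ := E.exists_cohomologyClass _ (Multiplicative.toAdd x).2
  have hx : x = Multiplicative.ofAdd
      (E.homologyClass rfl d hd hd', E.cohomologyClass c hc hc') := by
    rw [← h1, ← h2]
    rfl
  rw [hx]
  exact tendsto_nhds_unique (hP d hd hd' c hc hc' v) (hQ d hd hd' c hc hc' v)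

/-- The character `(z, w) ↦ e^{2πi(⟨[γ]^∞, w⟩ + ⟨z, [δ]_∞⟩)}` of
`H^∞_n(E; Ĝ) × H_∞^{n-1}(E; G)`. -/
def chargeCharacter (n : ℕ) (γ : E.cell → G →+ AddCircle (1 : ℚ)) (hγ : γ ∈ E.chains _ (n : ℤ))
    (hγ' : (E.boundary _ γ).support.Finite) (δ : E.cell → G) (hδ : δ ∈ E.chains G (n : ℤ))
    (hδ' : (E.coboundary G δ).support.Finite) : E.ChargeGroup G n →* Circle where
  toFun x := cis
    (E.pairingAtInfinity (n - 1)
        (E.homologyClass (sub_add_cancel (n : ℤ) 1).symm γ hγ hγ') (Multiplicative.toAdd x).2 +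
      E.pairingAtInfinity n (Multiplicative.toAdd x).1 (E.cohomologyClass δ hδ hδ'))
  map_one' := by
    simp [cis_zero]
  map_mul' x y := by
    rw [← cis_add]
    simp only [toAdd_mul, Prod.fst_add, Prod.snd_add, map_add, AddMonoidHom.add_apply]
    congr 1
    abel

end CellularData

end CellularKitaev

end

open CellularKitaev

/-! For a pair `(d, c)` with `∂d` and `∂ᵀc` finite, write `U(d, c) = X^{∂ᵀc} Z^{∂d}`. By the Weyl
relation, moving `Z^{∂d}` past `X^{∂ᵀc'}` costs the phase of `⟨∂d, ∂ᵀc'⟩ = ⟨∂∂d, c'⟩ = 0`, so `U` is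
a unitary representation of the group of such pairs, and so is each truncation `U_K(d, c) = U(d -
d_K, c - c_K)`.

Existence of the polarization rests on three facts. By local finiteness `U_K` eventually commutes
with every local observable, so it is asymptotically central
(`tendsto_commutator_truncatedUnitary`). For `K ≥ J` the product `U_K^* U_J` is `U` of a finite pair
vanishing on `J`, so the ground state condition makes `ω(U_K^* U_J)` close to `1`
(`IsAsymptoticGroundState.exists_truncatedUnitary_cauchy`). Hence the net is Cauchy on the cyclic
vector, by centrality on a dense set, and by isometry everywhere (`exists_strongLimit`). Finally, if
the class of `(d, c)` at infinity vanishes, then for large `K` the operator `U_K(d, c)` is `U` of a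
finite pair vanishing on `K`, so `ω(U_K(d, c)) → 1` and the limit is the identity
(`IsAsymptoticGroundState.tendsto_truncatedUnitary`, `strongLimit_eq_one`). The limit therefore
descends to the charge group.

The automorphism `ρ_(γ,δ)` multiplies `U_K(d, c)` by the phase of `⟨γ, ∂ᵀ(c - c_K)⟩ - ⟨∂(d - d_K),
δ⟩`. Adjointness of `∂` and `∂ᵀ` holds for the finite parts `c_K`, `d_K` but may fail for `c`, `d`.
Once `K` contains the supports of `∂γ` and `∂ᵀδ`, what remains is the defect `⟨γ, ∂ᵀc⟩ - ⟨∂γ, c⟩ +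
⟨d, ∂ᵀδ⟩ - ⟨∂d, δ⟩`, which is the pairing at infinity (`eventually_rho_truncatedUnitary`). For
finite `c`, `d` off those supports the phase is trivial, so `ω'` is again an asymptotic ground
state. Since `ρ_(γ,δ)` is onto, `[a] ↦ [ρ a]` is a unitary between the GNS spaces of `ω'` and `ω`
(`exists_gns_equiv_of_comp`); in the limit it carries the polarization of `ω'` to that of `ω` times
the character. -/

noncomputable section

namespace CellularKitaev

/-! ### Strong limits of unitaries in the GNS representation -/

section GNS

variable {A : Type*} [CStarAlgebra A] [PartialOrder A] [StarOrderedRing A] (f : A →ₚ[ℂ] ℂ)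

/-- The vector of the GNS space represented by an element of the algebra. -/
def gnsVec (a : A) : f.GNS := (f.toPreGNS a : f.GNS)

lemma gnsStarAlgHom_gnsVec (a b : A) : f.gnsStarAlgHom a (gnsVec f b) = gnsVec f (a * b) :=
  f.gnsNonUnitalStarAlgHom_apply_coe

lemma gnsVec_eq (a : A) : gnsVec f a = f.gnsStarAlgHom a (gnsVec f 1) := by
  rw [gnsStarAlgHom_gnsVec, mul_one]

lemma gnsVec_sub (a b : A) : gnsVec f (a - b) = gnsVec f a - gnsVec f b := by
  rw [gnsVec_eq f (a - b), map_sub, sub_apply, ← gnsVec_eq, ← gnsVec_eq]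

lemma denseRange_gnsVec : DenseRange (gnsVec f) :=
  UniformSpace.Completion.denseRange_coe.comp f.toPreGNS.surjective.denseRange
    (UniformSpace.Completion.continuous_coe _)

lemma continuous_gnsVec : Continuous (gnsVec f) := by
  have h : Continuous f.gnsStarAlgHom := map_continuous f.gnsStarAlgHom
  have h2 : gnsVec f = fun a => f.gnsStarAlgHom a (gnsVec f 1) := funext (gnsVec_eq f)
  rw [h2]
  exact h.clm_apply continuous_const

lemma norm_gnsVec_sq (a : A) : ‖gnsVec f a‖ ^ 2 = (f (star a * a)).re := by
  have h := congrArg Complex.re (f.preGNS_norm_sq (f.toPreGNS a))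
  have h2 : ‖gnsVec f a‖ = ‖f.toPreGNS a‖ := UniformSpace.Completion.norm_coe _
  rw [h2, ← Complex.ofReal_re (_ ^ 2)]
  push_cast
  exact h

/-- Since `u` and `w` are unitary, the left side equals `2 - 2 Re f(u* w)`. This turns the numerical
ground state condition into convergence of vectors. -/
lemma norm_gnsVec_sub_sq_le (hf : f 1 = 1) (u w : unitary A) :
    ‖gnsVec f (u : A) - gnsVec f (w : A)‖ ^ 2 ≤ 2 * ‖f (star (u : A) * w) - 1‖ := by
  have h : star ((u : A) - w) * (u - w) = 1 + 1 - star (u : A) * w - star (star (u : A) * w) := by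
    simp only [star_sub, star_mul, star_star, sub_mul, mul_sub, Unitary.coe_star_mul_self]
    abel
  have h1 : f (star (star (u : A) * w)) = star (f (star (u : A) * w)) := map_star f _
  rw [← gnsVec_sub, norm_gnsVec_sq, h, map_sub, map_sub, map_add, hf, h1]
  have h2 := Complex.abs_re_le_norm (f (star (u : A) * w) - 1)
  have h3 := (abs_le.1 h2).1
  simp only [Complex.sub_re, Complex.one_re] at h3
  simp only [Complex.sub_re, Complex.add_re, Complex.one_re, Complex.star_def, Complex.conj_re]
  linarith

lemma norm_gnsStarAlgHom_unitary (u : unitary A) (v : f.GNS) :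
    ‖f.gnsStarAlgHom (u : A) v‖ = ‖v‖ := by
  have h : f.gnsStarAlgHom (u : A) ∈ unitary (f.GNS →L[ℂ] f.GNS) := Unitary.map_mem _ u.2
  exact (Unitary.linearIsometryEquiv ⟨_, h⟩).norm_map v

section Net

variable {f} {ι : Type*} [SemilatticeSup ι]

/-- Write `u a = (u a - a u) + a u`. The commutator tends to zero in norm, so convergence on the
cyclic vector spreads to all vectors `[a]`. -/
lemma tendsto_gnsStarAlgHom_gnsVec {u : ι → unitary A}
    (hcomm : ∀ a : A, Tendsto (fun i => (u i : A) * a - a * u i) atTop (𝓝 0))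
    {w : f.GNS} (hw : Tendsto (fun i => gnsVec f (u i : A)) atTop (𝓝 w)) (a : A) :
    Tendsto (fun i => f.gnsStarAlgHom (u i : A) (gnsVec f a)) atTop
      (𝓝 (f.gnsStarAlgHom a w)) := by
  have h1 := ((continuous_gnsVec f).tendsto 0).comp (hcomm a)
  have h2 := ((f.gnsStarAlgHom a).continuous.tendsto w).comp hw
  have h3 := h1.add h2
  have h0 : gnsVec f 0 = 0 := by simpa using gnsVec_sub f 0 0
  rw [h0, zero_add] at h3
  refine h3.congr fun i => ?_
  change gnsVec f (_ - _) + f.gnsStarAlgHom a (gnsVec f _) = _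
  rw [gnsStarAlgHom_gnsVec, gnsStarAlgHom_gnsVec, gnsVec_sub, sub_add_cancel]

/-- The vectors `[u i]` form a Cauchy net, centrality gives convergence on the dense set of vectors
`[a]`, and since the operators are isometries convergence there implies convergence everywhere. -/
lemma exists_tendsto_gnsStarAlgHom [Nonempty ι] {u : ι → unitary A} (hf : f 1 = 1)
    (hcomm : ∀ a : A, Tendsto (fun i => (u i : A) * a - a * u i) atTop (𝓝 0))
    (hcauchy : ∀ ε : ℝ, 0 < ε → ∃ j, ∀ i ≥ j, ‖f (star (u i : A) * u j) - 1‖ < ε) (v : f.GNS) :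
    ∃ w, Tendsto (fun i => f.gnsStarAlgHom (u i : A) v) atTop (𝓝 w) := by
  have hc : CauchySeq fun i => gnsVec f (u i : A) := by
    refine Metric.cauchySeq_iff'.2 fun ε hε => ?_
    -- The bound on the squared distance is twice the deviation from `1`, whence `ε ^ 2 / 2`.
    obtain ⟨j, hj⟩ := hcauchy (ε ^ 2 / 2) (by positivity)
    refine ⟨j, fun i hi => ?_⟩
    rw [dist_eq_norm]
    refine lt_of_pow_lt_pow_left₀ 2 hε.le ((norm_gnsVec_sub_sq_le f hf _ _).trans_lt ?_)
    linarith [hj i hi]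
  obtain ⟨w, hw⟩ := cauchySeq_tendsto_of_complete hc
  apply cauchySeq_tendsto_of_complete
  refine Metric.cauchySeq_iff'.2 fun ε hε => ?_
  obtain ⟨a, ha⟩ := (denseRange_gnsVec f).exists_dist_lt v (show 0 < ε / 3 by positivity)
  obtain ⟨j, hj⟩ := Metric.cauchySeq_iff'.1
    (tendsto_gnsStarAlgHom_gnsVec hcomm hw a).cauchySeq (ε / 3) (by positivity)
  refine ⟨j, fun i hi => ?_⟩
  have h1 : ∀ k, dist (f.gnsStarAlgHom (u k : A) v) (f.gnsStarAlgHom (u k : A) (gnsVec f a))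
      < ε / 3 := fun k => by
    rwa [dist_eq_norm, ← map_sub, norm_gnsStarAlgHom_unitary, ← dist_eq_norm]
  have h2 := h1 j
  rw [dist_comm] at h2
  have := dist_triangle4 (f.gnsStarAlgHom (u i : A) v) (f.gnsStarAlgHom (u i : A) (gnsVec f a))
    (f.gnsStarAlgHom (u j : A) (gnsVec f a)) (f.gnsStarAlgHom (u j : A) v)
  linarith [h1 i, hj i hi]

/-- A net of group representations in the unitaries of a C*-algebra that is asymptotically central and
asymptotically constant in a state converges strongly in the GNS representation. -/
theorem exists_strongLimit [Nonempty ι] {L : Type*} [Group L] (U : ι → L →* unitary A) (hf : f 1 = 1)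
    (hcomm : ∀ x, ∀ a : A, Tendsto (fun i => (U i x : A) * a - a * U i x) atTop (𝓝 0))
    (hcauchy : ∀ x, ∀ ε : ℝ, 0 < ε →
      ∃ j, ∀ i ≥ j, ‖f (star (U i x : A) * U j x) - 1‖ < ε) :
    ∃ R : L →* unitary (f.GNS →L[ℂ] f.GNS), ∀ x v,
      Tendsto (fun i => f.gnsStarAlgHom (U i x : A) v) atTop
        (𝓝 ((R x : f.GNS →L[ℂ] f.GNS) v)) := by
  choose r hr using fun x v => exists_tendsto_gnsStarAlgHom hf (hcomm x) (hcauchy x) v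
  have hadd : ∀ x v w, r x (v + w) = r x v + r x w := fun x v w =>
    tendsto_nhds_unique (hr x (v + w)) (((hr x v).add (hr x w)).congr fun i => by rw [map_add])
  have hsmul : ∀ x (a : ℂ) v, r x (a • v) = a • r x v := fun x a v =>
    tendsto_nhds_unique (hr x (a • v)) (((hr x v).const_smul a).congr fun i => by rw [map_smul])
  have hnorm : ∀ x v, ‖r x v‖ = ‖v‖ := fun x v =>
    tendsto_nhds_unique (hr x v).norm
      (tendsto_const_nhds.congr fun i => (norm_gnsStarAlgHom_unitary f _ _).symm)
  have hone : ∀ v, r 1 v = v := fun v =>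
    tendsto_nhds_unique (hr 1 v) (tendsto_const_nhds.congr fun i => by simp)
  have hmul : ∀ x y v, r (x * y) v = r x (r y v) := fun x y v => by
    refine tendsto_nhds_unique (hr (x * y) v) ?_
    -- The operators of `U i x` are isometries, so replacing `U i y v` by its limit inside them
    -- costs an error tending to zero.
    have h1 : Tendsto (fun i => f.gnsStarAlgHom (U i x : A)
        (f.gnsStarAlgHom (U i y : A) v - r y v)) atTop (𝓝 0) := by
      refine tendsto_zero_iff_norm_tendsto_zero.2 ?_
      simp only [norm_gnsStarAlgHom_unitary]
      exact tendsto_iff_norm_sub_tendsto_zero.1 (hr y v)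
    have h2 := h1.add (hr x (r y v))
    rw [zero_add] at h2
    refine h2.congr fun i => ?_
    rw [map_sub, sub_add_cancel, map_mul]
    simp
  -- A strong limit of unitaries is in general only an isometry; here the limit at `x⁻¹` supplies
  -- the inverse.
  let e : L →* (f.GNS ≃ₗᵢ[ℂ] f.GNS) :=
    { toFun := fun x =>
        { toFun := r x
          invFun := r x⁻¹
          map_add' := hadd x
          map_smul' := hsmul x
          left_inv := fun v => by rw [← hmul, inv_mul_cancel, hone]
          right_inv := fun v => by rw [← hmul, mul_inv_cancel, hone]
          norm_map' := hnorm x }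
      map_one' := by ext v; exact hone v
      map_mul' := fun x y => by ext v; exact hmul x y v }
  exact ⟨(Unitary.linearIsometryEquiv.symm : _ ≃* unitary (f.GNS →L[ℂ] f.GNS)).toMonoidHom.comp e,
    hr⟩

/-- If `f(u i) → 1`, then `[u i]` tends to the cyclic vector `[1]`, and by centrality the limit
operator fixes every `[a]`. -/
lemma strongLimit_eq_one [Nonempty ι] {u : ι → unitary A} (hf : f 1 = 1)
    (hcomm : ∀ a : A, Tendsto (fun i => (u i : A) * a - a * u i) atTop (𝓝 0))
    (hu : Tendsto (fun i => f (u i : A)) atTop (𝓝 1)) {R : unitary (f.GNS →L[ℂ] f.GNS)}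
    (hR : ∀ v, Tendsto (fun i => f.gnsStarAlgHom (u i : A) v) atTop
      (𝓝 ((R : f.GNS →L[ℂ] f.GNS) v))) : R = 1 := by
  have hw : Tendsto (fun i => gnsVec f (u i : A)) atTop (𝓝 (gnsVec f 1)) := by
    rw [tendsto_iff_norm_sub_tendsto_zero]
    have h1 : Tendsto (fun i => 2 * ‖f (u i : A) - 1‖) atTop (𝓝 0) := by
      simpa using (tendsto_iff_norm_sub_tendsto_zero.1 hu).const_mul 2
    have h2 : Tendsto (fun i => ‖gnsVec f (u i : A) - gnsVec f 1‖ ^ 2) atTop (𝓝 0) := by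
      refine squeeze_zero (fun i => by positivity) (fun i => ?_) h1
      have := norm_gnsVec_sub_sq_le f hf 1 (u i)
      rw [norm_sub_rev]
      simpa using this
    simpa using h2.sqrt
  have h : ((R : f.GNS →L[ℂ] f.GNS) : f.GNS → f.GNS) = id := by
    refine (denseRange_gnsVec f).equalizer (R : f.GNS →L[ℂ] f.GNS).continuous continuous_id ?_
    funext a
    refine tendsto_nhds_unique (hR (gnsVec f a)) ?_
    have := tendsto_gnsStarAlgHom_gnsVec hcomm hw a
    rwa [← gnsVec_eq] at this
  ext v
  exact congrFun h v

end Net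

/-! ### GNS spaces under pullback by an endomorphism -/

/-- A surjective endomorphism `ρ` induces a unitary from the GNS space of `f ∘ ρ` to that
of `f`. -/
theorem exists_gns_equiv_of_comp (g : A →ₚ[ℂ] ℂ) (ρ : A →⋆ₐ[ℂ] A) (hρ : Function.Surjective ρ)
    (hg : ∀ a, g a = f (ρ a)) :
    ∃ V : g.GNS ≃ₗᵢ[ℂ] f.GNS, ∀ a v, V (g.gnsStarAlgHom a v) = f.gnsStarAlgHom (ρ a) (V v) := by
  -- The map `[a] ↦ [ρ a]` preserves norms because `g(a* a) = f((ρ a)* (ρ a))`; it is then extended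
  -- to the completion.
  let V₀ : g.PreGNS →ₗᵢ[ℂ] f.GNS :=
    { toLinearMap := (UniformSpace.Completion.toComplₗᵢ (𝕜 := ℂ) (E := f.PreGNS)).toLinearMap ∘ₗ
        f.toPreGNS.toLinearMap ∘ₗ (ρ : A →ₐ[ℂ] A).toLinearMap ∘ₗ g.ofPreGNS.toLinearMap
      norm_map' := fun x => by
        change ‖gnsVec f (ρ (g.ofPreGNS x))‖ = ‖x‖
        rw [← sq_eq_sq₀ (norm_nonneg _) (norm_nonneg _), norm_gnsVec_sq, ← map_star, ← map_mul,
          ← hg, ← g.preGNS_norm_sq, ← Complex.ofReal_pow, Complex.ofReal_re] }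
  let V₁ : g.GNS →L[ℂ] f.GNS := V₀.toContinuousLinearMap.extend
    (UniformSpace.Completion.toComplL (𝕜 := ℂ) (E := g.PreGNS))
  have hV₁ : ∀ a, V₁ (gnsVec g a) = gnsVec f (ρ a) := fun a =>
    ContinuousLinearMap.extend_eq _ UniformSpace.Completion.denseRange_coe
      (UniformSpace.Completion.isUniformInducing_coe _) (g.toPreGNS a)
  have hnorm : ∀ v, ‖V₁ v‖ = ‖v‖ := by
    refine fun v => congrFun ((denseRange_gnsVec g).equalizer (g := fun v => ‖V₁ v‖)
      (h := fun v => ‖v‖) V₁.continuous.norm continuous_norm ?_) v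
    funext a
    change ‖V₁ (gnsVec g a)‖ = ‖gnsVec g a‖
    rw [hV₁, ← sq_eq_sq₀ (norm_nonneg _) (norm_nonneg _), norm_gnsVec_sq, norm_gnsVec_sq,
      ← map_star, ← map_mul, ← hg]
  let V₂ : g.GNS →ₗᵢ[ℂ] f.GNS := ⟨V₁.toLinearMap, hnorm⟩
  -- The range of an isometry of a complete space is closed, and it contains every `[a]` because `ρ`
  -- is onto.
  have hsurj : Function.Surjective V₂ := by
    have hcl : IsClosed (Set.range V₂) := V₂.isometry.isClosedEmbedding.isClosed_range
    have hsub : Set.range (gnsVec f) ⊆ Set.range V₂ := by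
      rintro _ ⟨a, rfl⟩
      obtain ⟨b, rfl⟩ := hρ a
      exact ⟨gnsVec g b, hV₁ b⟩
    exact fun w => hcl.closure_subset_iff.2 hsub (denseRange_gnsVec f w)
  refine ⟨LinearIsometryEquiv.ofSurjective V₂ hsurj, fun a v => ?_⟩
  refine congrFun ((denseRange_gnsVec g).equalizer (g := fun v => V₁ (g.gnsStarAlgHom a v))
    (h := fun v => f.gnsStarAlgHom (ρ a) (V₁ v)) (by fun_prop) (by fun_prop) ?_) v
  funext b
  change V₁ (g.gnsStarAlgHom a (gnsVec g b)) = f.gnsStarAlgHom (ρ a) (V₁ (gnsVec g b))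
  rw [gnsStarAlgHom_gnsVec, hV₁, hV₁, gnsStarAlgHom_gnsVec, map_mul]

end GNS

/-! ### Commutation relations in the quasi-local algebra -/

lemma coe_unitary_mul_star {R : Type*} [Monoid R] [StarMul R] (U : unitary R) :
    (U : R) * star (U : R) = 1 :=
  Unitary.mul_star_self_of_mem U.2

/-- A net of unitaries that eventually commute with every element of a set is asymptotically central
in the C*-algebra generated by that set. -/
lemma tendsto_commutator_of_mem_closure {R ι : Type*} [CStarAlgebra R] {l : Filter ι}
    (W : ι → unitary R) (s : Set R) (hW : ∀ x ∈ s, ∀ᶠ i in l, Commute (W i : R) x) {A : R}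
    (hA : A ∈ (StarAlgebra.adjoin ℂ s).topologicalClosure) :
    Tendsto (fun i => (W i : R) * A - A * W i) l (𝓝 0) := by
  -- Passing from commutators to conjugation makes the statement one about *-automorphisms, so
  -- convergence on generators passes to sums, products and adjoints.
  have key : ∀ A : R, (fun i => ‖(W i : R) * A - A * W i‖) =
      fun i => ‖Unitary.conjStarAlgAut ℂ R (W i) A - A‖ := by
    intro A
    funext i
    have : Unitary.conjStarAlgAut ℂ R (W i) A - A =
        ((W i : R) * A - A * W i) * (star (W i) : unitary R) := by
      rw [Unitary.conjStarAlgAut_apply, sub_mul, mul_assoc A, Unitary.coe_star,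
        coe_unitary_mul_star, mul_one]
    rw [this, CStarRing.norm_mul_coe_unitary]
  have hadj : ∀ T ∈ StarAlgebra.adjoin ℂ s,
      Tendsto (fun i => Unitary.conjStarAlgAut ℂ R (W i) T) l (𝓝 T) := by
    intro T hT
    induction hT using StarAlgebra.adjoin_induction with
    | mem x hx =>
      refine tendsto_const_nhds.congr' ((hW x hx).mono fun i hi => ?_)
      beta_reduce
      rw [Unitary.conjStarAlgAut_apply, hi.eq, mul_assoc, coe_unitary_mul_star, mul_one]
    | algebraMap r =>
      exact tendsto_const_nhds.congr fun i =>
        (AlgHomClass.commutes (Unitary.conjStarAlgAut ℂ R (W i)) r).symm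
    | add x y _ _ hx hy =>
      exact (hx.add hy).congr fun i => (map_add (Unitary.conjStarAlgAut ℂ R (W i)) _ _).symm
    | mul x y _ _ hx hy =>
      exact (hx.mul hy).congr fun i => (map_mul (Unitary.conjStarAlgAut ℂ R (W i)) _ _).symm
    | star x _ hx =>
      exact hx.star.congr fun i => (map_star (Unitary.conjStarAlgAut ℂ R (W i)) _).symm
  rw [tendsto_zero_iff_norm_tendsto_zero]
  refine Metric.tendsto_nhds.2 fun ε hε => ?_
  obtain ⟨B, hB, hAB⟩ := Metric.mem_closure_iff.1
    (show A ∈ closure (StarAlgebra.adjoin ℂ s : Set R) from hA) (ε / 3) (by positivity)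
  have hB' : Tendsto (fun i => ‖(W i : R) * B - B * W i‖) l (𝓝 0) := by
    rw [key]
    exact tendsto_iff_norm_sub_tendsto_zero.1 (hadj B hB)
  rw [dist_eq_norm] at hAB
  filter_upwards [Metric.tendsto_nhds.1 hB' (ε / 3) (by positivity)] with i hi
  simp only [dist_zero_right, norm_norm] at hi ⊢
  -- Replacing `A` by the approximant `B` costs `‖A - B‖` twice, uniformly in `i`.
  have h1 : (W i : R) * A - A * W i =
      W i * (A - B) + (W i * B - B * W i) - (A - B) * W i := by
    rw [mul_sub, sub_mul]; abel
  calc ‖(W i : R) * A - A * W i‖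
      ≤ ‖(W i : R) * (A - B)‖ + ‖(W i : R) * B - B * W i‖ + ‖(A - B) * W i‖ := by
        rw [h1]
        exact (norm_sub_le _ _).trans (add_le_add_left (norm_add_le _ _) _)
    _ < ε := by
        rw [CStarRing.norm_mul_coe_unitary, CStarRing.norm_coe_unitary_mul]
        linarith

section QuasiLocal

variable {S : Type u} {G : Type v} [AddCommGroup G]

lemma QuasiLocal.ext_toOp {A B : QuasiLocal S G}
    (h : ∀ ψ k, QuasiLocal.toOp A ψ k = QuasiLocal.toOp B ψ k) : A = B :=
  Subtype.ext (by ext ψ k; exact h ψ k)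

lemma toOp_pauliX_apply (a : S →₀ G) (ψ : ConfigSpace S G) (h : S →₀ G) :
    QuasiLocal.toOp (pauliX a : QuasiLocal S G) ψ h = ψ (h - a) :=
  pauliXIso_apply a ψ h

lemma toOp_pauliZ_apply (b : S →₀ (G →+ AddCircle (1 : ℚ))) (ψ : ConfigSpace S G) (h : S →₀ G) :
    QuasiLocal.toOp (pauliZ b : QuasiLocal S G) ψ h = cis (b.sum fun s χ => χ (h s)) * ψ h :=
  pauliZIso_apply b ψ h

lemma toOp_mul_apply (A B : QuasiLocal S G) (ψ : ConfigSpace S G) :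
    QuasiLocal.toOp (A * B) ψ = QuasiLocal.toOp A (QuasiLocal.toOp B ψ) := by
  rw [map_mul]; rfl

lemma toOp_smul_apply (c : ℂ) (A : QuasiLocal S G) (ψ : ConfigSpace S G) (h : S →₀ G) :
    QuasiLocal.toOp (c • A) ψ h = c * QuasiLocal.toOp A ψ h := by
  rw [map_smul]; rfl

lemma pauliX_zero : pauliX (0 : S →₀ G) = 1 :=
  Subtype.ext <| QuasiLocal.ext_toOp fun ψ h => by
    rw [toOp_pauliX_apply, sub_zero]; rfl

lemma pauliX_add (a a' : S →₀ G) : pauliX (a + a') = pauliX a * pauliX a' :=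
  Subtype.ext <| QuasiLocal.ext_toOp fun ψ h => by
    rw [Submonoid.coe_mul, toOp_mul_apply, toOp_pauliX_apply, toOp_pauliX_apply,
      toOp_pauliX_apply, sub_sub]

lemma pauliZ_zero : pauliZ (0 : S →₀ (G →+ AddCircle (1 : ℚ))) = 1 :=
  Subtype.ext <| QuasiLocal.ext_toOp fun ψ h => by
    rw [toOp_pauliZ_apply, Finsupp.sum_zero_index, cis_zero, Circle.coe_one, one_mul]; rfl

lemma pauliZ_add (b b' : S →₀ (G →+ AddCircle (1 : ℚ))) :
    pauliZ (b + b') = pauliZ b * pauliZ b' :=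
  Subtype.ext <| QuasiLocal.ext_toOp fun ψ h => by
    classical
    rw [Submonoid.coe_mul, toOp_mul_apply, toOp_pauliZ_apply, toOp_pauliZ_apply,
      toOp_pauliZ_apply, Finsupp.sum_add_index' (fun _ => rfl) (fun _ _ _ => rfl), cis_add,
      Circle.coe_mul, mul_assoc]

lemma pauliZ_mul_comm (b b' : S →₀ (G →+ AddCircle (1 : ℚ))) :
    pauliZ b * pauliZ b' = pauliZ b' * pauliZ b :=
  Subtype.ext <| QuasiLocal.ext_toOp fun ψ h => by
    rw [Submonoid.coe_mul, Submonoid.coe_mul, toOp_mul_apply, toOp_mul_apply, toOp_pauliZ_apply,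
      toOp_pauliZ_apply, toOp_pauliZ_apply, toOp_pauliZ_apply, mul_left_comm]

/-- The Weyl relation, the source of every phase below: at a configuration `h`, the character sum
splits as `b(h) = b(a) + b(h - a)`. -/
lemma pauliZ_mul_pauliX (b : S →₀ (G →+ AddCircle (1 : ℚ))) (a : S →₀ G) :
    (pauliZ b * pauliX a : QuasiLocal S G) =
      (cis (b.sum fun s χ => χ (a s)) : ℂ) • (pauliX a * pauliZ b : QuasiLocal S G) :=
  QuasiLocal.ext_toOp fun ψ h => by
    have : (b.sum fun s χ => χ (h s)) =
        (b.sum fun s χ => χ (a s)) + b.sum fun s χ => χ ((h - a) s) := by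
      rw [← Finsupp.sum_add]
      exact Finsupp.sum_congr fun s _ => by rw [← map_add]; simp
    rw [toOp_smul_apply, toOp_mul_apply, toOp_mul_apply, toOp_pauliZ_apply, toOp_pauliX_apply,
      toOp_pauliX_apply, toOp_pauliZ_apply, this, cis_add, Circle.coe_mul, mul_assoc]

lemma pauliX_neg (a : S →₀ G) : pauliX (-a) = star (pauliX a) :=
  eq_inv_of_mul_eq_one_left (by rw [← pauliX_add, neg_add_cancel, pauliX_zero])

lemma pauliZ_neg (b : S →₀ (G →+ AddCircle (1 : ℚ))) : pauliZ (-b) = star (pauliZ b) :=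
  eq_inv_of_mul_eq_one_left ((pauliZ_add _ _).symm.trans <|
    (congrArg pauliZ (neg_add_cancel b)).trans pauliZ_zero)

/-! ### The string automorphisms -/

lemma tendsto_limitConj (W : Finset S → unitary (QuasiLocal S G)) (h) (A : QuasiLocal S G) :
    Tendsto (fun K => (W K : QuasiLocal S G) * A * star (W K : QuasiLocal S G)) atTop
      (𝓝 (limitConj W h A)) :=
  tendsto_nhds_limUnder (h A)

/-- Both limits may be taken along the same `K`: conjugation by `W K` is isometric and undoes
conjugation by `W' K`, so the error equals that of the inner limit. -/
lemma limitConj_limitConj (W W' : Finset S → unitary (QuasiLocal S G)) (h h')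
    (hW : ∀ K, W' K = star (W K)) (A : QuasiLocal S G) :
    limitConj W h (limitConj W' h' A) = A := by
  classical
  refine tendsto_nhds_unique (tendsto_limitConj W h _) ?_
  have h1 := tendsto_iff_norm_sub_tendsto_zero.1 (tendsto_limitConj W' h' A)
  refine tendsto_iff_norm_sub_tendsto_zero.2 (h1.congr fun K => ?_)
  have h2 : (W K : QuasiLocal S G) * limitConj W' h' A * star (W K : QuasiLocal S G) - A =
      W K * (limitConj W' h' A - W' K * A * star (W' K : QuasiLocal S G)) *
        (star (W K) : unitary (QuasiLocal S G)) := by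
    rw [hW, mul_sub, sub_mul]
    simp only [Unitary.coe_star, star_star, mul_assoc, coe_unitary_mul_star, mul_one]
    rw [← mul_assoc (W K : QuasiLocal S G) (star _), coe_unitary_mul_star, one_mul]
  rw [h2, CStarRing.norm_mul_coe_unitary, CStarRing.norm_coe_unitary_mul, norm_sub_rev]

lemma truncate_neg {A : Type*} [AddCommGroup A] (K : Finset S) (x : S → A) :
    truncate K (-x) = -truncate K x := by
  ext s
  classical
  by_cases hs : s ∈ K <;> simp [truncate, Finsupp.indicator_apply, hs]

lemma rhoX_neg_rhoX (δ : S → G) (A : QuasiLocal S G) : rhoX δ (rhoX (-δ) A) = A :=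
  limitConj_limitConj _ _ _ _ (fun K => by rw [truncate_neg, pauliX_neg]) A

lemma rhoZ_neg_rhoZ (γ : S → G →+ AddCircle (1 : ℚ)) (A : QuasiLocal S G) :
    rhoZ γ (rhoZ (-γ) A) = A :=
  limitConj_limitConj _ _ _ _ (fun K => by rw [truncate_neg, pauliZ_neg]) A

lemma rhoX_pauliX (δ : S → G) (a : S →₀ G) :
    rhoX δ (pauliX a : QuasiLocal S G) = pauliX a := by
  classical
  refine tendsto_nhds_unique (tendsto_limitConj _ _ _) (tendsto_const_nhds.congr fun K => ?_)
  rw [← Submonoid.coe_mul, ← pauliX_add, add_comm, pauliX_add, Submonoid.coe_mul, mul_assoc,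
    coe_unitary_mul_star, mul_one]

lemma rhoZ_pauliZ (γ : S → G →+ AddCircle (1 : ℚ)) (b : S →₀ (G →+ AddCircle (1 : ℚ))) :
    rhoZ γ (pauliZ b : QuasiLocal S G) = pauliZ b := by
  classical
  refine tendsto_nhds_unique (tendsto_limitConj _ _ _) (tendsto_const_nhds.congr fun K => ?_)
  rw [← Submonoid.coe_mul, pauliZ_mul_comm, Submonoid.coe_mul, mul_assoc,
    coe_unitary_mul_star, mul_one]

/-- The net defining the left side is constant as soon as `K` contains the support of `a`, and the
Weyl relation gives its value. -/
lemma rhoZ_pauliX (γ : S → G →+ AddCircle (1 : ℚ)) (a : S →₀ G) :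
    rhoZ γ (pauliX a : QuasiLocal S G) =
      (cis (pairing γ a) : ℂ) • (pauliX a : QuasiLocal S G) := by
  classical
  refine tendsto_nhds_unique (tendsto_limitConj _ _ _) (tendsto_const_nhds.congr' ?_)
  filter_upwards [eventually_ge_atTop a.support] with K hK
  have h : ((truncate K γ).sum fun s χ => χ (a s)) = pairing γ a := by
    rw [truncate, Finsupp.sum_indicator_index _ (by simp), pairing]
    refine (finsum_eq_sum_of_support_subset _ fun s hs => hK ?_).symm
    exact Finsupp.mem_support_iff.2 fun h0 => hs (by simp [h0])
  rw [pauliZ_mul_pauliX, h, smul_mul_assoc, mul_assoc, coe_unitary_mul_star, mul_one]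

/-- Here `X` is moved past `Z`, against the direction of the Weyl relation; hence the minus sign. -/
lemma rhoX_pauliZ (δ : S → G) (b : S →₀ (G →+ AddCircle (1 : ℚ))) :
    rhoX δ (pauliZ b : QuasiLocal S G) =
      (cis (-pairing b δ) : ℂ) • (pauliZ b : QuasiLocal S G) := by
  classical
  refine tendsto_nhds_unique (tendsto_limitConj _ _ _) (tendsto_const_nhds.congr' ?_)
  filter_upwards [eventually_ge_atTop b.support] with K hK
  have h : (b.sum fun s χ => χ (truncate K δ s)) = pairing b δ := by
    rw [pairing, Finsupp.sum]
    rw [finsum_eq_sum_of_support_subset (s := b.support)]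
    · refine Finset.sum_congr rfl fun s hs => ?_
      rw [truncate, Finsupp.indicator_of_mem (hK hs)]
    · intro s hs
      exact Finsupp.mem_support_iff.2 fun h0 => hs (by simp [h0])
  have h1 : (pauliX (truncate K δ) * pauliZ b : QuasiLocal S G) =
      (cis (-pairing b δ) : ℂ) • (pauliZ b * pauliX (truncate K δ) : QuasiLocal S G) := by
    rw [pauliZ_mul_pauliX, h, smul_smul, ← Circle.coe_mul, ← cis_add, neg_add_cancel, cis_zero,
      Circle.coe_one, one_smul]
  rw [h1, smul_mul_assoc, mul_assoc, coe_unitary_mul_star, mul_one]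

/-! ### Asymptotically central nets -/

/-- A translation that is trivial on `Λ` leaves the matrix indices on `Λ` unchanged and commutes
with replacing the values on `Λ`. -/
lemma commute_pauliX_of_local {Λ : Finset S} {A : QuasiLocal S G}
    (hA : QuasiLocal.toOp A ∈ localOperators Λ) {a : S →₀ G} (ha : ∀ s ∈ Λ, a s = 0) :
    Commute (pauliX a : QuasiLocal S G) A := by
  obtain ⟨M, hM⟩ := hA
  refine QuasiLocal.ext_toOp fun ψ h => ?_
  rw [toOp_mul_apply, toOp_mul_apply, toOp_pauliX_apply, hM, hM]
  refine finsum_congr fun k => ?_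
  rw [toOp_pauliX_apply]
  have h1 : (fun s : Λ => (h - a) s) = fun s : Λ => h s := by
    funext s
    simp [ha s s.2]
  have h2 : replaceOn (h - a) Λ k = replaceOn h Λ k - a := by
    ext s
    by_cases hs : s ∈ Λ
    · rw [Finsupp.sub_apply, replaceOn_apply_mem _ _ _ hs, replaceOn_apply_mem _ _ _ hs, ha s hs,
        sub_zero]
    · rw [Finsupp.sub_apply, replaceOn_apply_not_mem _ _ _ hs, replaceOn_apply_not_mem _ _ _ hs,
        Finsupp.sub_apply]
  rw [h1, h2]

/-- The phase of `Z^b` depends only on the values off `Λ`, which a local operator does not change.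
-/
lemma commute_pauliZ_of_local {Λ : Finset S} {A : QuasiLocal S G}
    (hA : QuasiLocal.toOp A ∈ localOperators Λ) {b : S →₀ (G →+ AddCircle (1 : ℚ))}
    (hb : ∀ s ∈ Λ, b s = 0) : Commute (pauliZ b : QuasiLocal S G) A := by
  obtain ⟨M, hM⟩ := hA
  refine QuasiLocal.ext_toOp fun ψ h => ?_
  rw [toOp_mul_apply, toOp_mul_apply, toOp_pauliZ_apply, hM, hM, ← smul_eq_mul, smul_finsum]
  refine finsum_congr fun k => ?_
  have h1 : (b.sum fun s χ => χ (replaceOn h Λ k s)) = b.sum fun s χ => χ (h s) := by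
    refine Finsupp.sum_congr fun s hs => ?_
    rw [replaceOn_apply_not_mem]
    exact fun h0 => Finsupp.mem_support_iff.1 hs (hb s h0)
  rw [toOp_pauliZ_apply, h1, smul_eq_mul]
  ring

/-- A net of unitaries that eventually commute with every local observable is asymptotically
central. -/
lemma tendsto_commutator_of_local {ι : Type*} {l : Filter ι} (W : ι → unitary (QuasiLocal S G))
    (hW : ∀ (Λ : Finset S) (A : QuasiLocal S G), QuasiLocal.toOp A ∈ localOperators Λ →
      ∀ᶠ i in l, Commute (W i : QuasiLocal S G) A) (A : QuasiLocal S G) :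
    Tendsto (fun i => (W i : QuasiLocal S G) * A - A * W i) l (𝓝 0) := by
  -- The argument runs in the algebra of all bounded operators, where the quasi-local algebra is the
  -- closure of the algebra generated by the local operators; the norm is the same.
  have h := tendsto_commutator_of_mem_closure (l := l)
    (fun i => (⟨QuasiLocal.toOp (W i : QuasiLocal S G), Unitary.map_mem _ (W i).2⟩ :
      unitary (ConfigSpace S G →L[ℂ] ConfigSpace S G)))
    (⋃ Λ : Finset S, localOperators Λ) (fun x hx => by
      obtain ⟨Λ, hx⟩ := Set.mem_iUnion.1 hx
      exact (hW Λ ⟨x, localOperators_subset Λ hx⟩ hx).mono fun i hi =>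
        hi.map (QuasiLocal.toOp : QuasiLocal S G →⋆ₐ[ℂ] _)) A.2
  rw [tendsto_zero_iff_norm_tendsto_zero] at h ⊢
  exact h

end QuasiLocal

/-! ### Locality of the boundary maps -/

section LocallyFiniteMatrix

variable {ι : Type u} {A : Type v} [AddCommGroup A]

/-- Each entry of `m y` involves only finitely many entries of `y`, as the columns of `m` are
finite. The predicates `p` and `q` stand for cells of given dimensions, so one statement serves `∂`
and `∂ᵀ`. -/
lemma exists_finset_matrixAct_eq_zero (m : ι → ι → ℤ) (hm : ∀ β, {α | m α β ≠ 0}.Finite)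
    (p q : ι → Prop) (Λ : Finset {β // q β}) :
    ∃ F : Finset {α // p α}, ∀ y : ι → A, (∀ α, y α ≠ 0 → p α) → (∀ α ∈ F, y α = 0) →
      ∀ σ ∈ Λ, matrixAct m hm y σ = 0 := by
  refine ⟨((Λ.finite_toSet.biUnion fun σ _ => hm σ.1).preimage
    Subtype.val_injective.injOn).toFinset, fun y hy hF σ hσ => ?_⟩
  rw [matrixAct_apply]
  refine finsum_eq_zero_of_forall_eq_zero fun α => ?_
  by_contra h0
  have h1 : m α σ ≠ 0 := fun h => h0 (by rw [h, zero_smul])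
  have h2 : y α ≠ 0 := fun h => h0 (by rw [h, smul_zero])
  refine h2 (hF ⟨α, hy α h2⟩ ?_)
  rw [Set.Finite.mem_toFinset]
  exact Set.mem_biUnion (x := σ) hσ h1

/-- The image of the part of a boundary away from a finite set `M` is the image of an element of
finite support that vanishes on `M`. -/
lemma exists_finite_matrixAct_eq (m : ι → ι → ℤ) (hm : ∀ β, {α | m α β ≠ 0}.Finite)
    (hm' : ∀ α, {β | m α β ≠ 0}.Finite) (hmm : ∀ α γ, ∑ᶠ β, m α β * m β γ = 0) (p q : ι → Prop)
    (hpq : ∀ x : ι → A, (∀ α, x α ≠ 0 → p α) → ∀ β, matrixAct m hm x β ≠ 0 → q β)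
    (f : ι → A) (hf : ∀ α, f α ≠ 0 → p α) (M : Finset {β // q β}) :
    ∃ y : ι → A, ((∀ β, y β ≠ 0 → q β) ∧ y.support.Finite) ∧ (∀ β ∈ M, y β = 0) ∧
      matrixAct m hm y = matrixAct m hm (matrixAct m hm f -
        Set.indicator (Subtype.val '' (M : Set {β // q β})) (matrixAct m hm f)) := by
  classical
  -- On `M` the image of `f` is determined by the finite part `fF` of `f`.
  obtain ⟨F, hF⟩ := exists_finset_matrixAct_eq_zero (A := A) m hm p q M
  set fF : ι → A := Set.indicator (Subtype.val '' (F : Set {α // p α})) f with hfF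
  set fM : ι → A :=
    Set.indicator (Subtype.val '' (M : Set {β // q β})) (matrixAct m hm f) with hfM
  have hp : ∀ α, fF α ≠ 0 → p α := fun α hα => hf α fun h0 => hα (by
    simp [hfF, Set.indicator_apply, h0])
  -- This element differs from `m f - fM` by `m (f - fF)`, which vanishes on `M` and is killed by
  -- `m` since `m² = 0`; but it has finite support.
  refine ⟨matrixAct m hm fF - fM, ⟨fun β hβ => ?_, ?_⟩, fun β hβ => ?_, ?_⟩
  · by_contra hq
    have h1 : matrixAct m hm fF β = 0 := by
      by_contra h1
      exact hq (hpq fF hp β h1)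
    have h2 : fM β = 0 := by
      by_contra h2
      exact hq (hpq f hf β fun h0 => h2 (by simp [hfM, Set.indicator_apply, h0]))
    exact hβ (by simp [h1, h2])
  · refine ((finite_support_matrixAct m hm hm' fF ?_).union ?_).subset (Function.support_sub _ _)
    · exact (F.finite_toSet.image _).subset Set.support_indicator_subset
    · exact (M.finite_toSet.image _).subset Set.support_indicator_subset
  · have h1 := hF (f - fF) (fun α hα => hf α fun h0 => hα (by
      simp [hfF, Set.indicator_apply, h0])) (fun α hα => by
        rw [Pi.sub_apply, hfF, Set.indicator_of_mem (Set.mem_image_of_mem _ hα), sub_self]) β hβ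
    rw [map_sub, Pi.sub_apply, sub_eq_zero] at h1
    rw [Pi.sub_apply, hfM, Set.indicator_of_mem (Set.mem_image_of_mem _ hβ), h1, sub_self]
  · rw [map_sub, map_sub, matrixAct_matrixAct m hm hmm, matrixAct_matrixAct m hm hmm]

end LocallyFiniteMatrix

/-! ### The pairing of chains and cochains -/

lemma pairing_zero_left {ι : Type u} {G : Type v} [AddCommGroup G] (y : ι → G) :
    pairing 0 y = 0 := by
  simp [pairing]

lemma pairing_congr_right {ι : Type u} {G : Type v} [AddCommGroup G]
    {x : ι → G →+ AddCircle (1 : ℚ)} {y y' : ι → G} (h : ∀ α, x α ≠ 0 → y α = y' α) :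
    pairing x y = pairing x y' :=
  finsum_congr fun α => by
    by_cases hα : x α = 0
    · rw [hα, AddMonoidHom.zero_apply, AddMonoidHom.zero_apply]
    · rw [h α hα]

lemma pairing_congr_left {ι : Type u} {G : Type v} [AddCommGroup G]
    {x x' : ι → G →+ AddCircle (1 : ℚ)} {y : ι → G} (h : ∀ α, y α ≠ 0 → x α = x' α) :
    pairing x y = pairing x' y :=
  finsum_congr fun α => by
    by_cases hα : y α = 0
    · rw [hα, map_zero, map_zero]
    · rw [h α hα]

lemma finsupp_sum_eq_pairing {ι : Type u} {G : Type v} [AddCommGroup G]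
    (b : ι →₀ (G →+ AddCircle (1 : ℚ))) (y : ι → G) :
    (b.sum fun s χ => χ (y s)) = pairing b y := by
  refine (finsum_eq_sum_of_support_subset (s := b.support) _ fun s hs => ?_).symm
  exact Finsupp.mem_support_iff.2 fun h0 => hs (by simp [h0])

namespace CellularData

variable (E : CellularData.{u}) {G : Type v} [AddCommGroup G]

/-- Adjointness applies with the finite chain `∂d` in the left slot, and `∂² = 0`; neither `d` nor
`c` need be finite. -/
lemma pairing_boundary_coboundary {d : E.cell → G →+ AddCircle (1 : ℚ)} {c : E.cell → G}
    (hd : (E.boundary _ d).support.Finite) :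
    pairing (E.boundary _ d) (E.coboundary G c) = 0 := by
  rw [← pairing_boundary _ _ _ (.inl hd), boundary_boundary, pairing_zero_left]

/-- The observables live on the `n`-cells only, whereas chains are functions on all cells;
homogeneity of one factor kills the other terms. -/
lemma pairing_cellsOfDim {i : ℤ} {x : E.cell → G →+ AddCircle (1 : ℚ)} {y : E.cell → G}
    (h : x ∈ E.chains _ i ∨ y ∈ E.chains G i) :
    pairing (fun σ : E.CellsOfDim i => x σ.1) (fun σ : E.CellsOfDim i => y σ.1) =
      pairing x y := by
  have h1 : Function.support (fun α => x α (y α)) ⊆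
      Set.range (Subtype.val : E.CellsOfDim i → E.cell) := by
    intro α hα
    rw [Subtype.range_coe_subtype]
    rcases h with h | h
    · exact h α fun h0 => hα (by simp [h0])
    · exact h α fun h0 => hα (by simp [h0])
  unfold pairing
  rw [← finsum_mem_range (f := fun α => x α (y α)) (g := (Subtype.val : E.CellsOfDim i → E.cell))
    Subtype.val_injective, ← finsum_mem_inter_support, Set.inter_eq_right.2 h1,
    finsum_mem_support]

/-! ### The unitary representation of pairs and its truncations -/

variable (G) in
/-- The group of pairs `(d, c)` of a locally finite `(n + 1)`-chain with finite boundary and an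
`(n - 1)`-cochain with finite coboundary. -/
def finBoundaryPairs (n : ℕ) : AddSubgroup ((E.cell → G →+ AddCircle (1 : ℚ)) × (E.cell → G)) where
  carrier := {x | (x.1 ∈ E.chains _ (n + 1) ∧ (E.boundary _ x.1).support.Finite) ∧
    x.2 ∈ E.chains G (n - 1) ∧ (E.coboundary G x.2).support.Finite}
  zero_mem' := ⟨⟨zero_mem _, by simp⟩, zero_mem _, by simp⟩
  add_mem' := fun hx hy => ⟨⟨add_mem hx.1.1 hy.1.1, by
      rw [Prod.fst_add, map_add]
      exact (hx.1.2.union hy.1.2).subset (Function.support_add _ _)⟩,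
    add_mem hx.2.1 hy.2.1, by
      rw [Prod.snd_add, map_add]
      exact (hx.2.2.union hy.2.2).subset (Function.support_add _ _)⟩
  neg_mem' := fun hx => ⟨⟨neg_mem hx.1.1, by
      rw [Prod.fst_neg, map_neg, Function.support_neg]
      exact hx.1.2⟩,
    neg_mem hx.2.1, by
      rw [Prod.snd_neg, map_neg, Function.support_neg]
      exact hx.2.2⟩

lemma onCells_congr {A : Type v} [AddCommGroup A] (n : ℕ) {x y : E.cell → A} (h : x = y) (hx hy) :
    E.onCells n x hx = E.onCells n y hy := by
  subst h; rfl

/-- The phase in the Weyl relation is that of `⟨∂d, ∂ᵀc⟩ = 0`. -/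
lemma pauliZ_mul_pauliX_boundary {n : ℕ} (x y : E.finBoundaryPairs G n) :
    pauliZ (E.onCells n (E.boundary _ x.1.1) x.2.1.2) *
        pauliX (E.onCells n (E.coboundary G y.1.2) y.2.2.2) =
      pauliX (E.onCells n (E.coboundary G y.1.2) y.2.2.2) *
        pauliZ (E.onCells n (E.boundary _ x.1.1) x.2.1.2) := by
  refine Subtype.ext ((pauliZ_mul_pauliX _ _).trans ?_)
  have h : pairing (E.onCells n (E.boundary _ x.1.1) x.2.1.2)
      (E.onCells n (E.coboundary G y.1.2) y.2.2.2) = 0 :=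
    (E.pairing_cellsOfDim (.inl (E.boundary_mem_chains x.2.1.1))).trans
      (E.pairing_boundary_coboundary x.2.1.2)
  rw [finsupp_sum_eq_pairing, h, cis_zero, Circle.coe_one, one_smul, Submonoid.coe_mul]

variable (G) in
/-- The unitaries `X^{∂ᵀc} Z^{∂d}` form a representation of the group of pairs `(d, c)`. -/
def groundUnitary (n : ℕ) :
    Multiplicative (E.finBoundaryPairs G n) →* unitary (E.Observables G n) where
  toFun x := pauliX (E.onCells n (E.coboundary G x.toAdd.1.2) x.toAdd.2.2.2) *
    pauliZ (E.onCells n (E.boundary _ x.toAdd.1.1) x.toAdd.2.1.2)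
  map_one' := by
    have h1 : E.onCells n (E.coboundary G 0) (by simp) = 0 :=
      Finsupp.ext fun σ => congrFun (map_zero (E.coboundary G)) σ.1
    have h2 : E.onCells n (E.boundary (G →+ AddCircle (1 : ℚ)) 0) (by simp) = 0 :=
      Finsupp.ext fun σ => congrFun (map_zero (E.boundary _)) σ.1
    exact (congrArg₂ (· * ·) ((congrArg pauliX h1).trans pauliX_zero)
      ((congrArg pauliZ h2).trans pauliZ_zero)).trans (one_mul 1)
  map_mul' x y := by
    have h1 : E.onCells n (E.coboundary G (x * y).toAdd.1.2) (x * y).toAdd.2.2.2 =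
        E.onCells n (E.coboundary G x.toAdd.1.2) x.toAdd.2.2.2 +
        E.onCells n (E.coboundary G y.toAdd.1.2) y.toAdd.2.2.2 := by
      ext σ
      exact congrFun (map_add (E.coboundary G) x.toAdd.1.2 y.toAdd.1.2) σ.1
    have h2 : E.onCells n (E.boundary _ (x * y).toAdd.1.1) (x * y).toAdd.2.1.2 =
        E.onCells n (E.boundary _ x.toAdd.1.1) x.toAdd.2.1.2 +
        E.onCells n (E.boundary _ y.toAdd.1.1) y.toAdd.2.1.2 :=
      Finsupp.ext fun σ => congrFun (map_add (E.boundary _) x.toAdd.1.1 y.toAdd.1.1) σ.1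
    -- The inner factors `Z` of `x` and `X` of `y` have to be exchanged.
    have h3 := E.pauliZ_mul_pauliX_boundary x.toAdd y.toAdd
    rw [h1, h2, pauliX_add]
    refine (congrArg _ (pauliZ_add _ _)).trans ?_
    rw [mul_assoc, mul_assoc, ← mul_assoc (pauliX _) (pauliZ _), ← h3, mul_assoc]

/-- This allows an infinite pair to be exchanged for a finite one, to which the ground state
condition applies. -/
lemma groundUnitary_congr {n : ℕ} {x y : E.finBoundaryPairs G n}
    (h1 : E.boundary _ x.1.1 = E.boundary _ y.1.1)
    (h2 : E.coboundary G x.1.2 = E.coboundary G y.1.2) :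
    E.groundUnitary G n (.ofAdd x) = E.groundUnitary G n (.ofAdd y) :=
  congrArg₂ (· * ·) (congrArg pauliX (E.onCells_congr n h2 _ _))
    (congrArg pauliZ (E.onCells_congr n h1 _ _))

lemma restrictTo_mem_chains {A : Type v} [AddCommGroup A] {i : ℤ} (K : Finset (E.CellsOfDim i))
    (x : E.cell → A) : E.restrictTo K x ∈ E.chains A i := by
  intro α hα
  obtain ⟨σ, _, rfl⟩ := Set.mem_of_indicator_ne_zero hα
  exact σ.2

lemma restrictTo_apply_mem {A : Type v} [AddCommGroup A] {i : ℤ} {K : Finset (E.CellsOfDim i)}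
    (x : E.cell → A) {σ : E.CellsOfDim i} (hσ : σ ∈ K) : E.restrictTo K x σ.1 = x σ.1 :=
  Set.indicator_of_mem (Set.mem_image_of_mem _ hσ) x

/-- The truncation `(d, c) ↦ (d - d_L, c - c_K)`. -/
def truncatePair (n : ℕ) (K : Finset (E.CellsOfDim (n - 1)) × Finset (E.CellsOfDim (n + 1))) :
    E.finBoundaryPairs G n →+ E.finBoundaryPairs G n where
  toFun x := ⟨(x.1.1 - E.restrictTo K.2 x.1.1, x.1.2 - E.restrictTo K.1 x.1.2),
    ⟨sub_mem x.2.1.1 (E.restrictTo_mem_chains _ _), E.finite_support_boundary_sub _ x.2.1.2⟩,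
    sub_mem x.2.2.1 (E.restrictTo_mem_chains _ _), E.finite_support_coboundary_sub _ x.2.2.2⟩
  map_zero' := by
    refine Subtype.ext (Prod.ext ?_ ?_) <;> simp [restrictTo]
  map_add' x y := by
    refine Subtype.ext (Prod.ext ?_ ?_)
    · simp only [AddSubgroup.coe_add, Prod.fst_add, restrictTo, Set.indicator_add', add_sub_add_comm]
    · simp only [AddSubgroup.coe_add, Prod.snd_add, restrictTo, Set.indicator_add', add_sub_add_comm]

variable {E} {n : ℕ}

lemma truncatePair_fst_apply {x : E.finBoundaryPairs G n}
    {K : Finset (E.CellsOfDim (n - 1)) × Finset (E.CellsOfDim (n + 1))}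
    {σ : E.CellsOfDim (n + 1)} (hσ : σ ∈ K.2) : (E.truncatePair n K x).1.1 σ.1 = 0 :=
  sub_eq_zero.2 (E.restrictTo_apply_mem _ hσ).symm

lemma truncatePair_snd_apply {x : E.finBoundaryPairs G n}
    {K : Finset (E.CellsOfDim (n - 1)) × Finset (E.CellsOfDim (n + 1))}
    {σ : E.CellsOfDim (n - 1)} (hσ : σ ∈ K.1) : (E.truncatePair n K x).1.2 σ.1 = 0 :=
  sub_eq_zero.2 (E.restrictTo_apply_mem _ hσ).symm

variable (E) in
/-- The representation by the truncated unitaries `X^{∂ᵀ(c - c_K)} Z^{∂(d - d_L)}`. -/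
def truncatedUnitary (n : ℕ)
    (K : Finset (E.CellsOfDim (n - 1)) × Finset (E.CellsOfDim (n + 1))) :
    Multiplicative (E.finBoundaryPairs G n) →* unitary (E.Observables G n) :=
  (E.groundUnitary G n).comp (AddMonoidHom.toMultiplicative (E.truncatePair n K))

/-- For finite `Λ`, only finitely many cells contribute to the boundary or coboundary on `Λ`. Once
`K` contains them, the truncated operator acts off `Λ` and commutes with the observables on `Λ`. -/
lemma tendsto_commutator_truncatedUnitary (x : Multiplicative (E.finBoundaryPairs G n))
    (A : E.Observables G n) :
    Tendsto (fun K => (E.truncatedUnitary n K x : E.Observables G n) * A -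
      A * E.truncatedUnitary n K x) atTop (𝓝 0) := by
  classical
  refine tendsto_commutator_of_local _ (fun Λ A hA => ?_) A
  obtain ⟨F₁, hF₁⟩ := exists_finset_matrixAct_eq_zero (A := G)
    (fun α β => E.incidence β α) E.finite_faces (fun α => (E.dim α : ℤ) = n - 1) _ Λ
  obtain ⟨F₂, hF₂⟩ := exists_finset_matrixAct_eq_zero (A := G →+ AddCircle (1 : ℚ))
    E.incidence E.finite_cofaces (fun α => (E.dim α : ℤ) = n + 1) _ Λ
  filter_upwards [eventually_ge_atTop (F₁, F₂)] with K hK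
  refine Commute.mul_left (commute_pauliX_of_local hA fun σ hσ => ?_)
    (commute_pauliZ_of_local hA fun σ hσ => ?_)
  · exact hF₁ _ (E.truncatePair n K x.toAdd).2.2.1
      (fun α hα => truncatePair_snd_apply (hK.1 hα)) σ hσ
  · exact hF₂ _ (E.truncatePair n K x.toAdd).2.1.1
      (fun α hα => truncatePair_fst_apply (hK.2 hα)) σ hσ

/-! ### Consequences of the ground state condition -/

variable {ω : E.Observables G n →ₚ[ℂ] ℂ}

lemma IsAsymptoticGroundState.exists_norm_sub_one_lt (hω : E.IsAsymptoticGroundState n ω) {ε : ℝ}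
    (hε : 0 < ε) :
    ∃ K : Finset (E.CellsOfDim (n - 1)) × Finset (E.CellsOfDim (n + 1)),
      ∀ z : E.finBoundaryPairs G n, z.1.1.support.Finite → z.1.2.support.Finite →
        (∀ α ∈ K.1, z.1.2 α = 0) → (∀ α ∈ K.2, z.1.1 α = 0) →
          ‖ω (E.groundUnitary G n (.ofAdd z) : E.Observables G n) - 1‖ < ε := by
  obtain ⟨K₁, K₂, hK⟩ := hω.2 ε hε
  exact ⟨(K₁, K₂), fun z h1 h2 h3 h4 => hK _ ⟨z.2.2.1, h2⟩ _ ⟨z.2.1.1, h1⟩ h3 h4⟩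

/-- Since `-(d - d_K) + (d - d_J) = d_K - d_J`, and likewise for `c`, the product comes from a
finite pair. For `K ≥ J` both truncations vanish on `J`, so the ground state condition applies to
it. -/
lemma IsAsymptoticGroundState.exists_truncatedUnitary_cauchy
    (hω : E.IsAsymptoticGroundState n ω) (x : Multiplicative (E.finBoundaryPairs G n)) {ε : ℝ}
    (hε : 0 < ε) :
    ∃ J, ∀ K ≥ J, ‖ω (star (E.truncatedUnitary n K x : E.Observables G n) *
      E.truncatedUnitary n J x) - 1‖ < ε := by
  obtain ⟨J, hJ⟩ := hω.exists_norm_sub_one_lt hε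
  refine ⟨J, fun K hK => ?_⟩
  have h1 : star (E.truncatedUnitary n K x : E.Observables G n) * E.truncatedUnitary n J x =
      (E.groundUnitary G n (.ofAdd (-E.truncatePair n K x.toAdd + E.truncatePair n J x.toAdd)) :
        E.Observables G n) := by
    rw [ofAdd_add, ofAdd_neg, map_mul, map_inv]
    rfl
  rw [h1]
  refine hJ _ ?_ ?_ (fun α hα => ?_) (fun α hα => ?_)
  · have : (-E.truncatePair n K x.toAdd + E.truncatePair n J x.toAdd).1.1 =
        E.restrictTo K.2 x.toAdd.1.1 - E.restrictTo J.2 x.toAdd.1.1 := by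
      change -(x.toAdd.1.1 - _) + (x.toAdd.1.1 - _) = _
      abel
    rw [this]
    exact ((E.finite_support_restrictTo _ _).union (E.finite_support_restrictTo _ _)).subset
      (Function.support_sub _ _)
  · have : (-E.truncatePair n K x.toAdd + E.truncatePair n J x.toAdd).1.2 =
        E.restrictTo K.1 x.toAdd.1.2 - E.restrictTo J.1 x.toAdd.1.2 := by
      change -(x.toAdd.1.2 - _) + (x.toAdd.1.2 - _) = _
      abel
    rw [this]
    exact ((E.finite_support_restrictTo _ _).union (E.finite_support_restrictTo _ _)).subset
      (Function.support_sub _ _)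
  · change -((E.truncatePair n K x.toAdd).1.2 α.1) + (E.truncatePair n J x.toAdd).1.2 α.1 = 0
    rw [truncatePair_snd_apply hα, truncatePair_snd_apply (hK.1 hα), neg_zero, zero_add]
  · change -((E.truncatePair n K x.toAdd).1.1 α.1) + (E.truncatePair n J x.toAdd).1.1 α.1 = 0
    rw [truncatePair_fst_apply hα, truncatePair_fst_apply (hK.2 hα), neg_zero, zero_add]

/-! ### Existence of the polarization -/

variable (E G) in
/-- The cycle at infinity `(-∂d, d)` of a pair `(d, c)`. -/
def pairCycle (n : ℕ) :
    E.finBoundaryPairs G n →+ E.cyclesAtInfinity (G →+ AddCircle (1 : ℚ)) n :=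
  AddMonoidHom.mk' (fun x => ⟨(-E.boundary _ x.1.1, x.1.1),
    E.mem_cyclesAtInfinity rfl x.2.1.1 x.2.1.2⟩) fun x y => by
      refine Subtype.ext (Prod.ext ?_ rfl)
      change -E.boundary _ (x.1.1 + y.1.1) = -E.boundary _ x.1.1 + -E.boundary _ y.1.1
      rw [map_add, neg_add]

variable (E G) in
/-- The cocycle at infinity `(-∂ᵀc, c)` of a pair `(d, c)`. -/
def pairCocycle (n : ℕ) : E.finBoundaryPairs G n →+ E.cocyclesAtInfinity G (n - 1) :=
  AddMonoidHom.mk' (fun x => ⟨(-E.coboundary _ x.1.2, x.1.2),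
    E.mem_cocyclesAtInfinity x.2.2.1 x.2.2.2⟩) fun x y => by
      refine Subtype.ext (Prod.ext ?_ rfl)
      change -E.coboundary _ (x.1.2 + y.1.2) = -E.coboundary _ x.1.2 + -E.coboundary _ y.1.2
      rw [map_add, neg_add]

variable (E G) in
/-- The class `([d]^∞, [c]_∞)` of a pair `(d, c)`. -/
def chargeClass (n : ℕ) : E.finBoundaryPairs G n →+
    E.HomologyAtInfinity (G →+ AddCircle (1 : ℚ)) n × E.CohomologyAtInfinity G (n - 1) :=
  ((QuotientAddGroup.mk' _).comp (E.pairCycle G n)).prod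
    ((QuotientAddGroup.mk' _).comp (E.pairCocycle G n))

lemma chargeClass_apply (x : E.finBoundaryPairs G n) :
    E.chargeClass G n x = (E.homologyClass rfl x.1.1 x.2.1.1 x.2.1.2,
      E.cohomologyClass x.1.2 x.2.2.1 x.2.2.2) := rfl

lemma chargeClass_surjective : Function.Surjective (E.chargeClass G n) := by
  rintro ⟨z, w⟩
  obtain ⟨d, hd, hd', rfl⟩ := E.exists_homologyClass _ z
  obtain ⟨c, hc, hc', rfl⟩ := E.exists_cohomologyClass _ w
  exact ⟨⟨(d, c), ⟨hd, hd'⟩, hc, hc'⟩, rfl⟩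

/-- This is the second component of `(-∂d, d) = (-∂b, b + ∂f)`; the first follows from it by `∂² =
0`. -/
lemma exists_eq_of_homologyClass_eq_zero {A : Type v} [AddCommGroup A] {i : ℤ} {d : E.cell → A}
    {hd : d ∈ E.chains A (i + 1)} {hd' : (E.boundary A d).support.Finite}
    (h : E.homologyClass rfl d hd hd' = 0) :
    ∃ b ∈ E.finChains A (i + 1), ∃ f ∈ E.chains A (i + 1 + 1), d = b + E.boundary A f := by
  obtain ⟨⟨b, f⟩, ⟨hb, hf⟩, hbf⟩ :=
    AddSubgroup.mem_addSubgroupOf.1 ((QuotientAddGroup.eq_zero_iff _).1 h)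
  exact ⟨b, hb, f, hf, (congrArg Prod.snd hbf).symm⟩

lemma exists_eq_of_cohomologyClass_eq_zero {A : Type v} [AddCommGroup A] {i : ℤ} {c : E.cell → A}
    {hc : c ∈ E.chains A i} {hc' : (E.coboundary A c).support.Finite}
    (h : E.cohomologyClass c hc hc' = 0) :
    ∃ a ∈ E.finChains A i, ∃ g ∈ E.chains A (i - 1), c = a + E.coboundary A g := by
  obtain ⟨⟨a, g⟩, ⟨ha, hg⟩, hag⟩ :=
    AddSubgroup.mem_addSubgroupOf.1 ((QuotientAddGroup.eq_zero_iff _).1 h)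
  exact ⟨a, ha, g, hg, (congrArg Prod.snd hag).symm⟩

variable (E) in
/-- The finite set of `i`-cells in the support of a chain of finite support. -/
def supportCells {A : Type v} [AddCommGroup A] (i : ℤ) {x : E.cell → A} (hx : x.support.Finite) :
    Finset (E.CellsOfDim i) :=
  (hx.preimage Subtype.val_injective.injOn).toFinset

lemma mem_supportCells {A : Type v} [AddCommGroup A] {i : ℤ} {x : E.cell → A}
    (hx : x.support.Finite) {σ : E.CellsOfDim i} (h : x σ.1 ≠ 0) : σ ∈ E.supportCells i hx :=
  (Set.Finite.mem_toFinset _).2 h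

lemma restrictTo_eq_self {A : Type v} [AddCommGroup A] {i : ℤ} {x : E.cell → A}
    (hx : x ∈ E.finChains A i) {K : Finset (E.CellsOfDim i)} (hK : E.supportCells i hx.2 ≤ K) :
    E.restrictTo K x = x := by
  funext α
  by_cases h : x α = 0
  · simp [restrictTo, h]
  · exact E.restrictTo_apply_mem (σ := ⟨α, hx.1 α h⟩) x (hK (mem_supportCells hx.2 h))

lemma sub_restrictTo_add {A : Type v} [AddCommGroup A] {i : ℤ} {x : E.cell → A}
    (hx : x ∈ E.finChains A i) {K : Finset (E.CellsOfDim i)} (hK : E.supportCells i hx.2 ≤ K)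
    (y : E.cell → A) : x + y - E.restrictTo K (x + y) = y - E.restrictTo K y := by
  have h : E.restrictTo K (x + y) = E.restrictTo K x + E.restrictTo K y := Set.indicator_add' _ _ _
  rw [h, restrictTo_eq_self hx hK, add_sub_add_left_eq_sub]

/-- Write `d = b + ∂f` and `c = a + ∂ᵀg` with `b`, `a` finite. Truncation beyond their supports
removes `b` and `a`, and the truncated `∂f` and `∂ᵀg` can be replaced by finite elements vanishing
on `K` without changing their boundary and coboundary. -/
lemma IsAsymptoticGroundState.tendsto_truncatedUnitary (hω : E.IsAsymptoticGroundState n ω)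
    {x : Multiplicative (E.finBoundaryPairs G n)} (hx : E.chargeClass G n x.toAdd = 0) :
    Tendsto (fun K => ω (E.truncatedUnitary n K x : E.Observables G n)) atTop (𝓝 1) := by
  classical
  obtain ⟨b, hb, f, hf, hbf⟩ := exists_eq_of_homologyClass_eq_zero
    (hd := x.toAdd.2.1.1) (hd' := x.toAdd.2.1.2) (congrArg Prod.fst hx)
  obtain ⟨a, ha, g, hg, hag⟩ := exists_eq_of_cohomologyClass_eq_zero
    (hc := x.toAdd.2.2.1) (hc' := x.toAdd.2.2.2) (congrArg Prod.snd hx)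
  refine Metric.tendsto_nhds.2 fun ε hε => ?_
  obtain ⟨J, hJ⟩ := hω.exists_norm_sub_one_lt hε
  filter_upwards [eventually_ge_atTop J,
    eventually_ge_atTop (E.supportCells (n - 1) ha.2, E.supportCells (n + 1) hb.2)] with K hK hK'
  obtain ⟨y₁, hy₁, hy₁', hy₁''⟩ := exists_finite_matrixAct_eq E.incidence E.finite_cofaces
    E.finite_faces E.incidence_comp (fun α => (E.dim α : ℤ) = n + 1 + 1)
    (fun α => (E.dim α : ℤ) = n + 1) (fun x hx => E.boundary_mem_chains hx) f hf K.2
  obtain ⟨y₂, hy₂, hy₂', hy₂''⟩ := exists_finite_matrixAct_eq (fun α β => E.incidence β α)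
    E.finite_faces E.finite_cofaces
    (fun α γ => by simpa only [mul_comm] using E.incidence_comp γ α)
    (fun α => (E.dim α : ℤ) = n - 1 - 1) (fun α => (E.dim α : ℤ) = n - 1)
    (fun x hx => by
      have h := E.coboundary_mem_chains (i := n - 1 - 1) hx
      rw [sub_add_cancel] at h
      exact h) g hg K.1
  let z : E.finBoundaryPairs G n := ⟨(y₁, y₂), ⟨hy₁.1, E.finite_support_boundary hy₁.2⟩,
    hy₂.1, E.finite_support_coboundary hy₂.2⟩
  have hz : E.truncatedUnitary n K x = E.groundUnitary G n (.ofAdd z) := by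
    refine E.groundUnitary_congr (Eq.trans ?_ hy₁''.symm) (Eq.trans ?_ hy₂''.symm)
    · refine congrArg (E.boundary _) (Eq.trans ?_ (sub_restrictTo_add hb hK'.2 (E.boundary _ f)))
      rw [← hbf]
      rfl
    · refine congrArg (E.coboundary _)
        (Eq.trans ?_ (sub_restrictTo_add ha hK'.1 (E.coboundary _ g)))
      rw [← hag]
      rfl
  rw [hz, dist_eq_norm]
  exact hJ z hy₁.2 hy₂.2 (fun α hα => hy₂' α (hK.1 hα)) fun α hα => hy₁' α (hK.2 hα)

end CellularData

/-- The charge group is a product of two quotients, not literally a quotient of the group of pairs,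
so descent is phrased for a surjection. -/
lemma exists_monoidHom_of_surjective {L Q H : Type*} [Group L] [Group Q] [Group H] (q : L →* Q)
    (hq : Function.Surjective q) (R : L →* H) (h : ∀ x, q x = 1 → R x = 1) :
    ∃ P : Q →* H, ∀ x, P (q x) = R x :=
  ⟨MonoidHom.liftOfSurjective q hq ⟨R, h⟩, fun x =>
    MonoidHom.liftOfRightInverse_comp_apply q _ (Function.rightInverse_surjInv hq) ⟨R, h⟩ x⟩

namespace CellularData

variable {E : CellularData.{u}} {G : Type v} [AddCommGroup G] {n : ℕ}
  {ω : E.Observables G n →ₚ[ℂ] ℂ}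

lemma coe_truncatedUnitary (d : E.cell → G →+ AddCircle (1 : ℚ)) (hd : d ∈ E.chains _ (n + 1))
    (hd' : (E.boundary _ d).support.Finite) (c : E.cell → G) (hc : c ∈ E.chains G (n - 1))
    (hc' : (E.coboundary G c).support.Finite)
    (K : Finset (E.CellsOfDim (n - 1)) × Finset (E.CellsOfDim (n + 1))) :
    (E.truncatedUnitary n K (.ofAdd ⟨(d, c), ⟨hd, hd'⟩, hc, hc'⟩) : E.Observables G n) =
      E.groundObservable n (c - E.restrictTo K.1 c) (E.finite_support_coboundary_sub K.1 hc')
        (d - E.restrictTo K.2 d) (E.finite_support_boundary_sub K.2 hd') := rfl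

variable (ω) in
/-- `P` is the polarization of `ω` exactly if it is the strong limit of the truncated unitaries. -/
lemma isPolarization_iff (P : E.ChargeGroup G n →* unitary (ω.GNS →L[ℂ] ω.GNS)) :
    E.IsPolarization n ω P ↔ ∀ (x : E.finBoundaryPairs G n) (v : ω.GNS),
      Tendsto (fun K => ω.gnsStarAlgHom (E.truncatedUnitary n K (.ofAdd x) : E.Observables G n) v)
        atTop (𝓝 ((P (.ofAdd (E.chargeClass G n x)) : ω.GNS →L[ℂ] ω.GNS) v)) := by
  constructor
  · rintro h ⟨⟨d, c⟩, ⟨hd, hd'⟩, hc, hc'⟩ v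
    have h1 := h d hd hd' c hc hc' v
    simp only [← coe_truncatedUnitary d hd hd' c hc hc'] at h1
    exact h1
  · intro h d hd hd' c hc hc' v
    have h1 := h ⟨(d, c), ⟨hd, hd'⟩, hc, hc'⟩ v
    simp only [coe_truncatedUnitary d hd hd' c hc hc', chargeClass_apply] at h1
    exact h1

/-- An asymptotic ground state has a polarization. -/
theorem IsAsymptoticGroundState.exists_isPolarization (hω : E.IsAsymptoticGroundState n ω) :
    ∃ P : E.ChargeGroup G n →* unitary (ω.GNS →L[ℂ] ω.GNS), E.IsPolarization n ω P := by
  classical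
  obtain ⟨R, hR⟩ := exists_strongLimit (E.truncatedUnitary n) hω.1
    tendsto_commutator_truncatedUnitary fun x ε hε => hω.exists_truncatedUnitary_cauchy x hε
  let q : Multiplicative (E.finBoundaryPairs G n) →* E.ChargeGroup G n :=
    AddMonoidHom.toMultiplicative (E.chargeClass G n)
  -- The limit depends only on the classes at infinity.
  have hker : ∀ x, q x = 1 → R x = 1 := fun x hx =>
    strongLimit_eq_one hω.1 (tendsto_commutator_truncatedUnitary x)
      (hω.tendsto_truncatedUnitary hx) (hR x)
  obtain ⟨P, hP⟩ := exists_monoidHom_of_surjective (L := Multiplicative (E.finBoundaryPairs G n))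
    (Q := E.ChargeGroup G n) q chargeClass_surjective R hker
  refine ⟨P, (isPolarization_iff ω P).2 fun x v => ?_⟩
  have h : P (.ofAdd (E.chargeClass G n x)) = R (.ofAdd x) := hP (.ofAdd x)
  rw [h]
  exact hR (.ofAdd x) v

/-! ### The action of the string automorphisms -/

/-- Only `ρ_γ` affects the factor `X^{∂ᵀc}` and only `ρ_δ` the factor `Z^{∂d}`, each by a scalar. -/
lemma rho_groundUnitary {γ : E.cell → G →+ AddCircle (1 : ℚ)} (hγ : γ ∈ E.chains _ (n : ℤ))
    {δ : E.cell → G} (hδ : δ ∈ E.chains G (n : ℤ)) (x : E.finBoundaryPairs G n) :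
    E.rho n γ δ (E.groundUnitary G n (.ofAdd x) : E.Observables G n) =
      (cis (pairing γ (E.coboundary G x.1.2) - pairing (E.boundary _ x.1.1) δ) : ℂ) •
        (E.groundUnitary G n (.ofAdd x) : E.Observables G n) := by
  have h1 : pairing (fun σ : E.CellsOfDim n => γ σ.1)
      (E.onCells n (E.coboundary G x.1.2) x.2.2.2) = pairing γ (E.coboundary G x.1.2) :=
    E.pairing_cellsOfDim (y := E.coboundary G x.1.2) (.inl hγ)
  have h2 : pairing (E.onCells n (E.boundary _ x.1.1) x.2.1.2)
      (fun σ : E.CellsOfDim n => δ σ.1) = pairing (E.boundary _ x.1.1) δ :=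
    E.pairing_cellsOfDim (x := E.boundary _ x.1.1) (.inr hδ)
  change rhoZ (fun σ : E.CellsOfDim n => γ σ.1) (rhoX (fun σ : E.CellsOfDim n => δ σ.1)
    (pauliX (E.onCells n (E.coboundary G x.1.2) x.2.2.2) *
      pauliZ (E.onCells n (E.boundary _ x.1.1) x.2.1.2) : E.Observables G n)) =
    _ • (pauliX (E.onCells n (E.coboundary G x.1.2) x.2.2.2) *
      pauliZ (E.onCells n (E.boundary _ x.1.1) x.2.1.2) : E.Observables G n)
  rw [map_mul, rhoX_pauliX, rhoX_pauliZ, map_mul, map_smul, rhoZ_pauliX, rhoZ_pauliZ, h1, h2,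
    smul_mul_smul_comm, ← Circle.coe_mul, ← cis_add, ← sub_eq_add_neg]

lemma rho_surjective (γ : E.cell → G →+ AddCircle (1 : ℚ)) (δ : E.cell → G) :
    Function.Surjective (E.rho n γ δ) := by
  intro A
  have h : rhoZ (fun σ : E.CellsOfDim n => γ σ.1) (rhoX (fun σ : E.CellsOfDim n => δ σ.1)
      (rhoX (-fun σ : E.CellsOfDim n => δ σ.1) (rhoZ (-fun σ : E.CellsOfDim n => γ σ.1) A))) =
        A := by
    rw [rhoX_neg_rhoX, rhoZ_neg_rhoZ]
  exact ⟨_, h⟩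

/-- The string automorphisms preserve asymptotic ground states. -/
theorem IsAsymptoticGroundState.compRho (hω : E.IsAsymptoticGroundState n ω)
    {γ : E.cell → G →+ AddCircle (1 : ℚ)} (hγ : γ ∈ E.chains _ (n : ℤ))
    (hγ' : (E.boundary _ γ).support.Finite) {δ : E.cell → G} (hδ : δ ∈ E.chains G (n : ℤ))
    (hδ' : (E.coboundary G δ).support.Finite) :
    E.IsAsymptoticGroundState n (E.compRho n ω γ δ) := by
  classical
  refine ⟨by rw [compRho_apply, map_one, hω.1], fun ε hε => ?_⟩
  obtain ⟨K₁, K₂, hK⟩ := hω.2 ε hε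
  -- For finite `c`, `d` the phase is that of `⟨∂γ, c⟩ - ⟨d, ∂ᵀδ⟩`, so enlarging the sets by the
  -- supports of `∂γ` and `∂ᵀδ` makes it trivial, with the same `ε`.
  refine ⟨K₁ ∪ E.supportCells _ hγ', K₂ ∪ E.supportCells _ hδ', fun c hc d hd h1 h2 => ?_⟩
  let x : E.finBoundaryPairs G n := ⟨(d, c), ⟨hd.1, E.finite_support_boundary hd.2⟩,
    hc.1, E.finite_support_coboundary hc.2⟩
  have h3 : pairing γ (E.coboundary G c) = 0 := by
    rw [← pairing_boundary _ _ _ (.inr hc.2), pairing_congr_right (y' := 0), pairing]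
    · simp
    · intro α hα
      have hdim := E.boundary_mem_chains (i := n - 1) (by rwa [sub_add_cancel]) α hα
      exact h1 ⟨α, hdim⟩ (Finset.mem_union_right _ (mem_supportCells hγ' hα))
  have h4 : pairing (E.boundary _ d) δ = 0 := by
    rw [pairing_boundary _ _ _ (.inl hd.2), pairing_congr_left (x' := 0), pairing_zero_left]
    intro α hα
    have hdim := E.coboundary_mem_chains hδ α hα
    exact h2 ⟨α, hdim⟩ (Finset.mem_union_right _ (mem_supportCells hδ' hα))
  have h5 : E.rho n γ δ (E.groundUnitary G n (.ofAdd x) : E.Observables G n) =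
      (E.groundUnitary G n (.ofAdd x) : E.Observables G n) := by
    rw [rho_groundUnitary hγ hδ]
    change (cis (pairing γ (E.coboundary G c) - pairing (E.boundary _ d) δ) : ℂ) • _ = _
    rw [h3, h4, sub_zero, cis_zero, Circle.coe_one, one_smul]
  rw [compRho_apply]
  change ‖ω (E.rho n γ δ (E.groundUnitary G n (.ofAdd x) : E.Observables G n)) - 1‖ < ε
  rw [h5]
  exact hK c hc d hd (fun α hα => h1 α (Finset.mem_union_left _ hα))
    fun α hα => h2 α (Finset.mem_union_left _ hα)

/-- The pairing at infinity measures the failure of `∂` and `∂ᵀ` to be adjoint on infinite elements.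
Adjointness does hold for the finite parts cut off by `K`, and the terms `⟨∂γ, c_K⟩` and `⟨d_K,
∂ᵀδ⟩` are stable once `K` contains the supports of `∂γ` and `∂ᵀδ`. -/
lemma eventually_rho_truncatedUnitary {γ : E.cell → G →+ AddCircle (1 : ℚ)}
    (hγ : γ ∈ E.chains _ (n : ℤ)) (hγ' : (E.boundary _ γ).support.Finite) {δ : E.cell → G}
    (hδ : δ ∈ E.chains G (n : ℤ)) (hδ' : (E.coboundary G δ).support.Finite)
    (x : E.finBoundaryPairs G n) :
    ∀ᶠ K in atTop, E.rho n γ δ (E.truncatedUnitary n K (.ofAdd x) : E.Observables G n) =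
      (E.chargeCharacter n γ hγ hγ' δ hδ hδ' (.ofAdd (E.chargeClass G n x)) : ℂ) •
        (E.truncatedUnitary n K (.ofAdd x) : E.Observables G n) := by
  classical
  filter_upwards [eventually_ge_atTop
    (E.supportCells (n - 1) hγ', E.supportCells (n + 1) hδ')] with K hK
  have h1 : pairing γ (E.coboundary G (x.1.2 - E.restrictTo K.1 x.1.2)) =
      pairing γ (E.coboundary G x.1.2) - pairing (E.boundary _ γ) x.1.2 := by
    have hfin := E.finite_support_restrictTo K.1 x.1.2
    have h2 : pairing (E.boundary _ γ) (E.restrictTo K.1 x.1.2) =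
        pairing (E.boundary _ γ) x.1.2 := by
      refine pairing_congr_right fun α hα => ?_
      have hdim := E.boundary_mem_chains (i := n - 1) (by rwa [sub_add_cancel]) α hα
      exact E.restrictTo_apply_mem (σ := ⟨α, hdim⟩) _ (hK.1 (mem_supportCells hγ' hα))
    rw [map_sub, sub_eq_add_neg, pairing_add_right (.inr ⟨x.2.2.2, by
      simpa using E.finite_support_coboundary hfin⟩), pairing_neg_right,
      ← pairing_boundary _ _ _ (.inr hfin), h2, ← sub_eq_add_neg]
  have h3 : pairing (E.boundary _ (x.1.1 - E.restrictTo K.2 x.1.1)) δ =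
      pairing (E.boundary _ x.1.1) δ - pairing x.1.1 (E.coboundary G δ) := by
    have hfin := E.finite_support_restrictTo K.2 x.1.1
    have h2 : pairing (E.restrictTo K.2 x.1.1) (E.coboundary G δ) =
        pairing x.1.1 (E.coboundary G δ) := by
      refine pairing_congr_left fun α hα => ?_
      have hdim := E.coboundary_mem_chains hδ α hα
      exact E.restrictTo_apply_mem (σ := ⟨α, hdim⟩) _ (hK.2 (mem_supportCells hδ' hα))
    rw [map_sub, sub_eq_add_neg, pairing_add_left (.inr ⟨x.2.1.2, by
      rw [Function.support_neg]; exact E.finite_support_boundary hfin⟩), pairing_neg_left,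
      pairing_boundary _ _ _ (.inl hfin), h2, ← sub_eq_add_neg]
  have h4 : E.chargeCharacter n γ hγ hγ' δ hδ hδ' (.ofAdd (E.chargeClass G n x)) =
      cis (pairing γ (E.coboundary G (x.1.2 - E.restrictTo K.1 x.1.2)) -
        pairing (E.boundary _ (x.1.1 - E.restrictTo K.2 x.1.1)) δ) := by
    change cis (E.pairingAtInfinity (n - 1) (E.homologyClass _ γ hγ hγ')
        (E.cohomologyClass x.1.2 x.2.2.1 x.2.2.2) +
      E.pairingAtInfinity n (E.homologyClass rfl x.1.1 x.2.1.1 x.2.1.2)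
        (E.cohomologyClass δ hδ hδ')) = _
    rw [pairingAtInfinity_class, pairingAtInfinity_class, h1, h3]
    congr 1
    abel
  rw [h4]
  exact rho_groundUnitary hγ hδ (E.truncatePair n K x)

/-- The string automorphisms multiply the polarization by a character. -/
theorem IsPolarization.exists_intertwiner {γ : E.cell → G →+ AddCircle (1 : ℚ)}
    (hγ : γ ∈ E.chains _ (n : ℤ)) (hγ' : (E.boundary _ γ).support.Finite) {δ : E.cell → G}
    (hδ : δ ∈ E.chains G (n : ℤ)) (hδ' : (E.coboundary G δ).support.Finite)
    {P : E.ChargeGroup G n →* unitary (ω.GNS →L[ℂ] ω.GNS)} (hP : E.IsPolarization n ω P)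
    {P' : E.ChargeGroup G n →*
      unitary ((E.compRho n ω γ δ).GNS →L[ℂ] (E.compRho n ω γ δ).GNS)}
    (hP' : E.IsPolarization n (E.compRho n ω γ δ) P') :
    ∃ V : (E.compRho n ω γ δ).GNS ≃ₗᵢ[ℂ] ω.GNS, ∀ x v,
      V ((P' x : (E.compRho n ω γ δ).GNS →L[ℂ] (E.compRho n ω γ δ).GNS) v) =
        (E.chargeCharacter n γ hγ hγ' δ hδ hδ' x : ℂ) • (P x : ω.GNS →L[ℂ] ω.GNS) (V v) := by
  classical
  obtain ⟨V, hV⟩ := exists_gns_equiv_of_comp ω (E.compRho n ω γ δ) (E.rho n γ δ)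
    (rho_surjective γ δ) fun A => rfl
  refine ⟨V, fun x v => ?_⟩
  obtain ⟨y, hy⟩ := chargeClass_surjective (E := E) (G := G) (n := n) x.toAdd
  obtain rfl : x = .ofAdd (E.chargeClass G n y) := by rw [hy, ofAdd_toAdd]
  have h1 := (V.continuous.tendsto _).comp ((isPolarization_iff _ P').1 hP' y v)
  have h2 := ((isPolarization_iff ω P).1 hP y (V v)).const_smul
    (E.chargeCharacter n γ hγ hγ' δ hδ hδ' (.ofAdd (E.chargeClass G n y)) : ℂ)
  -- The two nets agree eventually: `V` turns the action of `U_K` into that of `ρ(U_K)`, which for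
  -- large `K` is the character value times `U_K`.
  refine tendsto_nhds_unique h1 (h2.congr' ?_)
  filter_upwards [eventually_rho_truncatedUnitary hγ hγ' hδ hδ' y] with K hK
  rw [Function.comp_apply, hV, hK, map_smul, smul_apply]

end CellularData

end CellularKitaev

end

/-! ### The main theorem -/

theorem proposition7p6 {X : Type u} [TopologicalSpace X] [T2Space X] (C : Set X)
    [Topology.CWComplex C] (o : CellOrientation C) (ho : o.IsLocallyFinite)
    (E : CellularData.{u}) (hE : E = o.cellularData ho)
    (G : Type v) [AddCommGroup G] [Finite G] (n : ℕ)
    (ω : E.Observables G n →ₚ[ℂ] ℂ) (hω : E.IsAsymptoticGroundState n ω)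
    (γ : E.cell → G →+ AddCircle (1 : ℚ)) (hγ : γ ∈ E.chains (G →+ AddCircle (1 : ℚ)) n)
    (hγ' : (E.boundary (G →+ AddCircle (1 : ℚ)) γ).support.Finite)
    (δ : E.cell → G) (hδ : δ ∈ E.chains G n) (hδ' : (E.coboundary G δ).support.Finite) :
    E.IsAsymptoticGroundState n (E.compRho n ω γ δ) ∧
      ∃ (P : E.ChargeGroup G n →* unitary (ω.GNS →L[ℂ] ω.GNS))
        (P' : E.ChargeGroup G n →*
          unitary ((E.compRho n ω γ δ).GNS →L[ℂ] (E.compRho n ω γ δ).GNS)),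
        E.IsPolarization n ω P ∧
        E.IsPolarization n (E.compRho n ω γ δ) P' ∧
        ∃ U : (E.compRho n ω γ δ).GNS ≃ₗᵢ[ℂ] (ω.GNS ⊗[ℂ] ℂ),
          ∀ (x : E.ChargeGroup G n) (v : (E.compRho n ω γ δ).GNS),
            U ((P' x : (E.compRho n ω γ δ).GNS →L[ℂ] (E.compRho n ω γ δ).GNS) v) =
              TensorProduct.map ((P x : ω.GNS →L[ℂ] ω.GNS) : ω.GNS →ₗ[ℂ] ω.GNS)
                ((E.chargeCharacter n γ hγ hγ' δ hδ hδ' x : ℂ) •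
                  (LinearMap.id : ℂ →ₗ[ℂ] ℂ)) (U v) := by
  have hω' := hω.compRho hγ hγ' hδ hδ'
  obtain ⟨P, hP⟩ := hω.exists_isPolarization
  obtain ⟨P', hP'⟩ := hω'.exists_isPolarization
  obtain ⟨V, hV⟩ := hP.exists_intertwiner hγ hγ' hδ hδ' hP'
  -- The intertwiner is followed by `v ↦ v ⊗ 1`; the character value then moves across the tensor
  -- sign.
  refine ⟨hω', P, P', hP, hP', V.trans (TensorProduct.ridIsometry ℂ ω.GNS).symm, fun x v => ?_⟩
  rw [LinearIsometryEquiv.trans_apply, LinearIsometryEquiv.trans_apply,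
    TensorProduct.symm_ridIsometry_apply, TensorProduct.symm_ridIsometry_apply, hV,
    TensorProduct.map_tmul, LinearMap.smul_apply, LinearMap.id_apply, TensorProduct.tmul_smul,
    TensorProduct.smul_tmul']
  rfl
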